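/- Let $n\ge 0$ and let $d\mu(u)=\prod_{j=1}^n \pi^{-1}e^{-|u_j|^2}\,dx_j\,dy_j$ ($u_j=x_j+\mathrm i y_j$) be the Gaussian measure on $\mathbb C^n$. Let $\mathcal H$ be the space of functions $f(\bar u)$, with $f$ entire on $\mathbb C^n$, that are square integrable with respect to $\mu$, with inner product $\langle f|g\rangle=\int\overline{f(\bar u)}\,g(\bar u)\,d\mu(u)$. On $\mathcal H$ let $a_j=\partial/\partial\bar u_j$ and $a_j^\dagger=$ multiplication by $\bar u_j$. Let $\Phi,\Psi$ be complex $n\times n$ matrices with $$\Phi\Psi^{T}=\Psi\Phi^{T},\qquad \Phi\Phi^{*}-\Psi\Psi^{*}=I,$$ and put $$b_j=\sum_{k=1}^n(\Phi_{jk}a_k+\Psi_{jk}a_k^\dagger),\qquad b_j^\dagger=\sum_{k=1}^n(\overline{\Phi_{jk}}\,a_k^\dagger+\overline{\Psi_{jk}}\,a_k).$$ Each of the operators $a_j,a_j^\dagger,b_j,b_j^\dagger$ has as its domain all $f\in\mathcal H$ for which the resulting entire function belongs to $\mathcal H$. A unitary operator $U$ on $\mathcal H$ is said to implement the transformation if $b_jU=Ua_j$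 and $b_j^\dagger U=Ua_j^\dagger$ for all $j$, as equalities of operators including their domains. It has integral kernel $K$ if, for all $f\in\mathcal H$ and all $u\in\mathbb C^n$, $(Uf)(\bar u)=\int K(\bar u,v)f(\bar v)\,d\mu(v)$ with an absolutely convergent integral. Then $\Phi$ is invertible, and the block matrix $A=\begin{pmatrix}A^{11}&A^{12}\\A^{21}&A^{22}\end{pmatrix}$ with $$A^{11}=\bar\Psi\Phi^{-1},\quad A^{12}=(\Phi^{-1})^{T},\quad A^{21}=\Phi^{-1},\quad A^{22}=-\Phi^{-1}\Psi$$ is symmetric, i.e. $A^{jk}=(A^{kj})^{T}$. For $\theta\in\mathbb C$ with $|\theta|=1$ let $$K_\theta(\bar u,v)=c\,\exp\Big(\tfrac12\,(v\ \ \bar u)\,A\begin{pmatrix}v\\ \bar u\end{pmatrix}\Big),\qquad c=\theta\,(\det\Phi\Phi^{*})^{-1/4}.$$ For every $\theta$ with $|\theta|=1$ there is a unitary operator $U$ on $\mathcal H$ that implements the transformation and has integral kernel $K_\theta$. Conversely, every unitary operator on $\mathcal H$ that implements the transformation has integral kernel $K_\theta$ for some $\theta$ with $|\theta|=1$. -/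

import Mathlib

open MeasureTheory Matrix

noncomputable section

/-- The Gaussian measure `∏ⱼ exp (-ūⱼ uⱼ) dūⱼ duⱼ / (2πi)` on `ℂⁿ`, where
`dū du / (2i)` is Lebesgue measure `dx dy` on `ℂ`. -/
def bargmannMeasure (n : ℕ) : Measure (Fin n → ℂ) :=
  (volume : Measure (Fin n → ℂ)).withDensity
    fun u => ENNReal.ofReal (∏ j, (Real.exp (-‖u j‖ ^ 2) / Real.pi))

/-- The entire functions `f` on `ℂⁿ` such that `u ↦ f ū` is square integrable for the Gaussian
measure. The argument of `f` plays the role of the variable `ū`. -/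
def bargmannSubmodule (n : ℕ) : Submodule ℂ ((Fin n → ℂ) → ℂ) where
  carrier := {f | Differentiable ℂ f ∧ MemLp (fun u => f (star u)) 2 (bargmannMeasure n)}
  add_mem' := fun hf hg => ⟨hf.1.add hg.1, hf.2.add hg.2⟩
  zero_mem' := ⟨differentiable_const 0, MemLp.zero⟩
  smul_mem' := fun c _ hf => ⟨hf.1.const_smul c, hf.2.const_smul c⟩

/-- The Hilbert space of the holomorphic (Bargmann) representation with `n` degrees of freedom.
It is a type of its own, so that its topology is that of its norm and not the pointwise one. -/
def BargmannSpace (n : ℕ) : Type := ↥(bargmannSubmodule n)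

namespace BargmannSpace

variable {n : ℕ}

instance : AddCommGroup (BargmannSpace n) := inferInstanceAs (AddCommGroup ↥(bargmannSubmodule n))

instance : Module ℂ (BargmannSpace n) := inferInstanceAs (Module ℂ ↥(bargmannSubmodule n))

instance : CoeFun (BargmannSpace n) (fun _ => (Fin n → ℂ) → ℂ) := ⟨fun f => f.1⟩

/-- The inner product `⟨f|g⟩ = ∫ conj (f ū) * g ū dμ(u)`. -/
instance : Inner ℂ (BargmannSpace n) :=
  ⟨fun f g => ∫ u, star (f (star u)) * g (star u) ∂(bargmannMeasure n)⟩

theorem integrable_inner (f g : BargmannSpace n) :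
    Integrable (fun u => star (f (star u)) * g (star u)) (bargmannMeasure n) :=
  MemLp.integrable_mul (p := 2) (q := 2) f.2.2.star g.2.2

theorem ae_of_ae_bargmannMeasure {p : (Fin n → ℂ) → Prop}
    (h : ∀ᵐ u ∂(bargmannMeasure n), p u) : ∀ᵐ u, p u := by
  unfold bargmannMeasure at h
  rw [ae_withDensity_iff (by fun_prop)] at h
  filter_upwards [h] with u hu
  refine hu ?_
  have : 0 < ∏ j, (Real.exp (-‖u j‖ ^ 2) / Real.pi) :=
    Finset.prod_pos fun j _ => div_pos (Real.exp_pos _) Real.pi_pos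
  simpa using this

theorem eq_zero_of_inner_self (f : BargmannSpace n) (h : inner ℂ f f = 0) : f = 0 := by
  have e : ∀ u : Fin n → ℂ,
      star (f (star u)) * f (star u) = ((‖f (star u)‖ ^ 2 : ℝ) : ℂ) := by
    intro u
    rw [Complex.star_def, Complex.conj_mul', Complex.ofReal_pow]
  have hi : Integrable (fun u => ‖f (star u)‖ ^ 2) (bargmannMeasure n) := by
    have := (integrable_inner f f).re
    refine this.congr (Filter.Eventually.of_forall fun u => ?_)
    simp only [e]
    exact Complex.ofReal_re _
  have h0 : ∫ u, ‖f (star u)‖ ^ 2 ∂(bargmannMeasure n) = 0 := by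
    have h' : ∫ u, star (f (star u)) * f (star u) ∂(bargmannMeasure n) = 0 := h
    simp only [e] at h'
    rw [integral_complex_ofReal] at h'
    exact_mod_cast h'
  rw [integral_eq_zero_iff_of_nonneg (fun u => by positivity) hi] at h0
  have hc : Continuous fun u : Fin n → ℂ => ‖f (star u)‖ ^ 2 :=
    ((f.2.1.continuous.comp continuous_star).norm).pow 2
  have h1 := Continuous.ae_eq_iff_eq (volume : Measure (Fin n → ℂ)) hc continuous_zero |>.1
    (ae_of_ae_bargmannMeasure h0)
  refine Subtype.ext (funext fun z => ?_)
  have h2 : f z = 0 := by simpa using congrFun h1 (star z)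
  exact h2

/-- The laws of the inner product. -/
abbrev innerCore (n : ℕ) : InnerProductSpace.Core ℂ (BargmannSpace n) where
  conj_inner_symm := fun f g => by
    change (starRingEnd ℂ) (∫ u, _ ∂_) = ∫ u, _ ∂_
    rw [← integral_conj]
    refine integral_congr_ae (Filter.Eventually.of_forall fun u => ?_)
    simp [mul_comm]
  re_inner_nonneg := fun f => by
    change 0 ≤ Complex.re (∫ u, star (f (star u)) * f (star u) ∂_)
    have e : ∀ u : Fin n → ℂ,
        star (f (star u)) * f (star u) = ((‖f (star u)‖ ^ 2 : ℝ) : ℂ) := by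
      intro u
      rw [Complex.star_def, Complex.conj_mul', Complex.ofReal_pow]
    simp only [e]
    rw [integral_complex_ofReal, Complex.ofReal_re]
    exact integral_nonneg fun u => by positivity
  add_left := fun f g h => by
    change ∫ u, _ ∂_ = (∫ u, _ ∂_) + ∫ u, _ ∂_
    rw [← integral_add (integrable_inner f h) (integrable_inner g h)]
    refine integral_congr_ae (Filter.Eventually.of_forall fun u => ?_)
    change star (f (star u) + g (star u)) * _ = _
    simp [add_mul]
  smul_left := fun f g r => by
    change ∫ u, _ ∂_ = _ * ∫ u, _ ∂_
    rw [← integral_const_mul]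
    refine integral_congr_ae (Filter.Eventually.of_forall fun u => ?_)
    change star (r * f (star u)) * _ = _
    simp [mul_assoc]
  definite := eq_zero_of_inner_self

instance : NormedAddCommGroup (BargmannSpace n) :=
  @InnerProductSpace.Core.toNormedAddCommGroup ℂ (BargmannSpace n) _ _ _ (innerCore n)

instance : InnerProductSpace ℂ (BargmannSpace n) := InnerProductSpace.ofCore (innerCore n).toCore

end BargmannSpace

/-- The annihilation operator `aⱼ = ∂/∂ūⱼ`, as a differential expression. -/
def annihilation {n : ℕ} (j : Fin n) (f : (Fin n → ℂ) → ℂ) : (Fin n → ℂ) → ℂ :=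
  fun z => fderiv ℂ f z (Pi.single j 1)

/-- The creation operator `aⱼ†`, multiplication by `ūⱼ`. -/
def creation {n : ℕ} (j : Fin n) (f : (Fin n → ℂ) → ℂ) : (Fin n → ℂ) → ℂ :=
  fun z => z j * f z

/-- `bⱼ = ∑ₖ (Φⱼₖ aₖ + Ψⱼₖ aₖ†)`. -/
def bogoliubovAnnihilation {n : ℕ} (Φ Ψ : Matrix (Fin n) (Fin n) ℂ) (j : Fin n)
    (f : (Fin n → ℂ) → ℂ) : (Fin n → ℂ) → ℂ :=
  ∑ k, (Φ j k • annihilation k f + Ψ j k • creation k f)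

/-- `bⱼ† = ∑ₖ (conj Φⱼₖ aₖ† + conj Ψⱼₖ aₖ)`. -/
def bogoliubovCreation {n : ℕ} (Φ Ψ : Matrix (Fin n) (Fin n) ℂ) (j : Fin n)
    (f : (Fin n → ℂ) → ℂ) : (Fin n → ℂ) → ℂ :=
  ∑ k, (star (Φ j k) • creation k f + star (Ψ j k) • annihilation k f)

/-- The unitary `U` implements the transformation: `bⱼ U = U aⱼ` and `bⱼ† U = U aⱼ†`.
These are equalities of unbounded operators, domains included, where each of the expressions
`aⱼ`, `aⱼ†`, `bⱼ`, `bⱼ†` acts on all `f` in the space for which the result lies in the space again.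
They are written through graphs: `(f, g)` is in the graph of `aⱼ` if and only if `(U f, U g)` is in
the graph of `bⱼ`, and likewise for `aⱼ†` and `bⱼ†`. -/
structure Implements {n : ℕ} (U : BargmannSpace n ≃ₗᵢ[ℂ] BargmannSpace n)
    (Φ Ψ : Matrix (Fin n) (Fin n) ℂ) : Prop where
  annihilation_iff : ∀ (j : Fin n) (f g : BargmannSpace n),
    bogoliubovAnnihilation Φ Ψ j (U f) = U g ↔ annihilation j f = g
  creation_iff : ∀ (j : Fin n) (f g : BargmannSpace n),
    bogoliubovCreation Φ Ψ j (U f) = U g ↔ creation j f = g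

/-- `U` is given by the integral kernel `K`: for all `f` in the space and all `w` (standing
for `ū`), the integral `∫ K(ū, v) f(v̄) dμ(v)` converges absolutely and equals `(U f)(ū)`. -/
def HasIntegralKernel {n : ℕ} (U : BargmannSpace n ≃ₗᵢ[ℂ] BargmannSpace n)
    (K : (Fin n → ℂ) → (Fin n → ℂ) → ℂ) : Prop :=
  ∀ (f : BargmannSpace n) (w : Fin n → ℂ),
    Integrable (fun v => K w v * f (star v)) (bargmannMeasure n) ∧
      U f w = ∫ v, K w v * f (star v) ∂(bargmannMeasure n)

/-- The block matrix `A` with `A¹¹ = Ψ̄ Φ⁻¹`, `A¹² = (Φ⁻¹)ᵀ`, `A²¹ = Φ⁻¹`, `A²² = -Φ⁻¹ Ψ`. -/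
def bogoliubovMatrix {n : ℕ} (Φ Ψ : Matrix (Fin n) (Fin n) ℂ) :
    Matrix (Fin n ⊕ Fin n) (Fin n ⊕ Fin n) ℂ :=
  Matrix.fromBlocks (Ψ.map star * Φ⁻¹) (Φ⁻¹)ᵀ Φ⁻¹ (-(Φ⁻¹ * Ψ))

/-- The kernel `c exp (½ (v ū) A (v ū)ᵀ)` with `c = θ (det Φ Φ†)^(-1/4)`; here `w` stands
for `ū`. -/
def bogoliubovKernel {n : ℕ} (Φ Ψ : Matrix (Fin n) (Fin n) ℂ) (θ : ℂ) (w v : Fin n → ℂ) : ℂ :=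
  θ * (Φ * Φᴴ).det ^ (-(1 / 4) : ℂ) *
    Complex.exp (1 / 2 * (Sum.elim v w ⬝ᵥ (bogoliubovMatrix Φ Ψ *ᵥ Sum.elim v w)))

end

/-! The proof rests on the coherent vectors `e_p(z) = exp (z·p)`. The Gaussian measure reproduces
point values, `⟨e_p, f⟩ = f(p̄)`, so these vectors are total, and a unitary `U` has integral kernel
`K(z, p) = (U e_p)(z)` (`hasIntegralKernel_of_apply_coherent`). Everything reduces to determining `U
e_p`.

Uniqueness. Since `a_j e_p = p_j e_p`, the function `g = U e_p` solves `Φ ∇g + Ψ z g = p g`. Its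
solutions are the multiples of `exp (½ z·Sz + z·Φ⁻¹p)` with `S = -Φ⁻¹Ψ`. The factor `(U e_p)(0)` is
the conjugate of `x(p̄)` with `x = U⁻¹ e_0`, and the creation relation at `z = 0` is again a first
order system, now for `x`; it yields `exp (½ p·Ψ̄Φ⁻¹p)`. The norm of `U e_0` fixes the modulus of
the remaining constant.

Existence. Let `k_p` be the kernel, without its constant, as a function of `z`. If `⟨k_p, k_q⟩ =
|det Φ| ⟨e_p, e_q⟩`, a Hilbert space argument gives the unitary
(`exists_linearIsometryEquiv_of_inner_eq`). The inverse transformation has coefficients `Φᴴ`, `-Ψᵀ`,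
and its kernel is the adjoint kernel, so pairing with `k_p` is the inverse kernel transform. As
`k_q` is an eigenvector of every `b_j`, intertwining gives a differential equation in `p̄` that
leaves only `‖k_0‖²` unknown (`inner_kernelVec_kernelVec`). This Gaussian integral is found by
multiplying the integrals for `S` and `-S`, which agree, and completing squares
(`gaussLIntegral_mul_neg`).

Domains. A vector of the space is `O(exp (½|z|²))`, and its images under `a_j`, `a_j†` are `O(exp
(q|z|²))` for every `q > ½`. Because `|u|² - |Su|² = |Φ⁻ᵀu|²`, the Gaussians in the kernel have
exponent strictly below `½`. Hence the transforms of `a_j f`, `a_j† f` converge even when these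
functions leave the space, and the intertwining relations hold as identities of functions, for the
kernel and for its inverse. This gives both directions of the graph equalities. -/

noncomputable section

namespace Bargmann

variable {n : ℕ}

/-! ### The Gaussian weight and functions of Gaussian growth -/

/-- The squared Euclidean norm on `ℂⁿ`. -/
def sqNorm (u : Fin n → ℂ) : ℝ := ∑ j, ‖u j‖ ^ 2

/-- The density of the Gaussian measure. -/
def weight (u : Fin n → ℂ) : ℝ := ∏ j, (Real.exp (-‖u j‖ ^ 2) / Real.pi)

lemma sqNorm_nonneg (u : Fin n → ℂ) : 0 ≤ sqNorm u := Finset.sum_nonneg fun _ _ => by positivity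

lemma sqNorm_star (u : Fin n → ℂ) : sqNorm (star u) = sqNorm u := by simp [sqNorm]

@[fun_prop]
lemma continuous_sqNorm : Continuous (sqNorm : (Fin n → ℂ) → ℝ) := by unfold sqNorm; fun_prop

lemma norm_sq_le_sqNorm (u : Fin n → ℂ) (j : Fin n) : ‖u j‖ ^ 2 ≤ sqNorm u :=
  Finset.single_le_sum (f := fun i => ‖u i‖ ^ 2) (fun _ _ => by positivity) (Finset.mem_univ j)

lemma weight_eq (u : Fin n → ℂ) : weight u = (Real.pi ^ n)⁻¹ * Real.exp (-sqNorm u) := by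
  simp only [weight, sqNorm, Finset.prod_div_distrib, ← Finset.sum_neg_distrib, Real.exp_sum]
  simp [div_eq_inv_mul]

lemma weight_pos (u : Fin n → ℂ) : 0 < weight u :=
  Finset.prod_pos fun _ _ => div_pos (Real.exp_pos _) Real.pi_pos

@[fun_prop]
lemma continuous_weight : Continuous (weight : (Fin n → ℂ) → ℝ) := by unfold weight; fun_prop

lemma bargmannMeasure_eq : bargmannMeasure n =
    (volume : Measure (Fin n → ℂ)).withDensity fun u => ENNReal.ofReal (weight u) := rfl

lemma integrable_bargmannMeasure_iff {g : (Fin n → ℂ) → ℂ} :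
    Integrable g (bargmannMeasure n) ↔ Integrable (fun u => (weight u : ℂ) * g u) := by
  rw [bargmannMeasure_eq, integrable_withDensity_iff_integrable_smul' (by fun_prop) (by simp)]
  refine integrable_congr (Filter.Eventually.of_forall fun u => ?_)
  simp [ENNReal.toReal_ofReal (weight_pos u).le]

lemma integral_bargmannMeasure (g : (Fin n → ℂ) → ℂ) :
    ∫ u, g u ∂(bargmannMeasure n) = ∫ u, (weight u : ℂ) * g u := by
  rw [bargmannMeasure_eq, integral_withDensity_eq_integral_toReal_smul (by fun_prop) (by simp)]
  refine integral_congr_ae (Filter.Eventually.of_forall fun u => ?_)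
  simp [ENNReal.toReal_ofReal (weight_pos u).le]

lemma integrable_exp_neg_mul_sqNorm {a : ℝ} (ha : 0 < a) :
    Integrable (fun u : Fin n → ℂ => Real.exp (-(a * sqNorm u))) := by
  have h1 : Integrable (fun z : ℂ => Real.exp (-(a * ‖z‖ ^ 2))) := by
    have := (GaussianFourier.integrable_cexp_neg_mul_sq_norm_add (V := ℂ) (b := a)
      (by simpa using ha) 0 0).norm
    refine this.congr (Filter.Eventually.of_forall fun z => ?_)
    simp [Complex.norm_exp, ← Complex.ofReal_pow, -Complex.inner]
  have := Integrable.fintype_prod (f := fun (_ : Fin n) (z : ℂ) => Real.exp (-(a * ‖z‖ ^ 2)))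
    (μ := fun _ => volume) fun _ => h1
  refine this.congr (Filter.Eventually.of_forall fun z => ?_)
  simp [sqNorm, ← Real.exp_sum, Finset.mul_sum]

lemma integral_weight : ∫ u : Fin n → ℂ, weight u = 1 := by
  unfold weight
  rw [integral_fintype_prod_volume_eq_prod (fun _ (z : ℂ) => Real.exp (-‖z‖ ^ 2) / Real.pi)]
  refine Finset.prod_eq_one fun _ _ => ?_
  have := GaussianFourier.integral_rexp_neg_mul_sq_norm (V := ℂ) (b := 1) one_pos
  simp only [Complex.finrank_real_complex, neg_mul, one_mul] at this
  rw [integral_div, this]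
  simp [Real.pi_ne_zero]

/-- `f` is dominated by a multiple of `exp (q |z|²)`. -/
def GaussianBound (q : ℝ) (f : (Fin n → ℂ) → ℂ) : Prop :=
  ∃ C, ∀ z, ‖f z‖ ≤ C * Real.exp (q * sqNorm z)

namespace GaussianBound

variable {q q' : ℝ} {f g : (Fin n → ℂ) → ℂ}

lemma exists_nonneg (hf : GaussianBound q f) :
    ∃ C, 0 ≤ C ∧ ∀ z, ‖f z‖ ≤ C * Real.exp (q * sqNorm z) := by
  obtain ⟨C, hC⟩ := hf
  refine ⟨max C 0, le_max_right _ _, fun z => (hC z).trans ?_⟩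
  gcongr
  exact le_max_left _ _

lemma mono (hf : GaussianBound q f) (h : q ≤ q') : GaussianBound q' f := by
  obtain ⟨C, hC0, hC⟩ := hf.exists_nonneg
  refine ⟨C, fun z => (hC z).trans ?_⟩
  have := sqNorm_nonneg z
  gcongr

lemma mul (hf : GaussianBound q f) (hg : GaussianBound q' g) :
    GaussianBound (q + q') (fun z => f z * g z) := by
  obtain ⟨C, hC0, hC⟩ := hf.exists_nonneg
  obtain ⟨D, hD0, hD⟩ := hg.exists_nonneg
  refine ⟨C * D, fun z => ?_⟩
  rw [norm_mul, add_mul, Real.exp_add]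
  calc _ ≤ _ := mul_le_mul (hC z) (hD z) (norm_nonneg _) (by positivity)
    _ = _ := by ring

lemma add (hf : GaussianBound q f) (hg : GaussianBound q g) :
    GaussianBound q (fun z => f z + g z) := by
  obtain ⟨C, hC⟩ := hf
  obtain ⟨D, hD⟩ := hg
  exact ⟨C + D, fun z => by linarith [norm_add_le (f z) (g z), hC z, hD z]⟩

lemma const_mul (hf : GaussianBound q f) (c : ℂ) : GaussianBound q (fun z => c * f z) := by
  obtain ⟨C, hC⟩ := hf
  refine ⟨‖c‖ * C, fun z => ?_⟩
  rw [norm_mul, mul_assoc]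
  exact mul_le_mul_of_nonneg_left (hC z) (norm_nonneg _)

lemma sum {ι : Type*} (s : Finset ι) {F : ι → (Fin n → ℂ) → ℂ}
    (h : ∀ i ∈ s, GaussianBound q (F i)) : GaussianBound q (fun z => ∑ i ∈ s, F i z) := by
  classical
  induction s using Finset.induction_on with
  | empty => exact ⟨0, fun z => by simp⟩
  | insert i s hi ih =>
    simp only [Finset.sum_insert hi]
    exact (h i (by simp)).add (ih fun j hj => h j (by simp [hj]))

lemma comp_star (hf : GaussianBound q f) : GaussianBound q (fun z => f (star z)) := by
  obtain ⟨C, hC⟩ := hf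
  exact ⟨C, fun z => by simpa [sqNorm_star] using hC (star z)⟩

lemma star (hf : GaussianBound q f) : GaussianBound q (fun z => star (f z)) := by
  obtain ⟨C, hC⟩ := hf
  exact ⟨C, fun z => by simpa using hC z⟩

lemma integrable (hf : GaussianBound q f) (hq : q < 1) (hc : Measurable f) :
    Integrable f (bargmannMeasure n) := by
  obtain ⟨C, hC⟩ := hf
  rw [integrable_bargmannMeasure_iff]
  have h := ((integrable_exp_neg_mul_sqNorm (n := n) (sub_pos.2 hq)).const_mul
    ((Real.pi ^ n)⁻¹ * C))
  refine h.mono' (by fun_prop) (Filter.Eventually.of_forall fun u => ?_)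
  rw [norm_mul, Complex.norm_real, Real.norm_of_nonneg (weight_pos u).le, weight_eq]
  calc _ ≤ (Real.pi ^ n)⁻¹ * Real.exp (-sqNorm u) * (C * Real.exp (q * sqNorm u)) := by
        gcongr; exact hC u
    _ = (Real.pi ^ n)⁻¹ * C * (Real.exp (-sqNorm u) * Real.exp (q * sqNorm u)) := by ring
    _ = _ := by rw [← Real.exp_add]; ring_nf

lemma mem (hf : GaussianBound q f) (hq : q < 1 / 2) (hd : Differentiable ℂ f) :
    f ∈ bargmannSubmodule n := by
  refine ⟨hd, ?_⟩
  have hc : Continuous fun u => f (Star.star u) := hd.continuous.comp continuous_star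
  rw [memLp_two_iff_integrable_sq_norm hc.aestronglyMeasurable]
  have h := (((hf.comp_star.mul hf.comp_star).integrable (by linarith)
    (hc.mul hc).measurable)).norm
  simpa [sq] using h

/-- A polynomial factor is absorbed by an arbitrarily small increase of the exponent: `|z_j| ≤ 1 +
|z|²`, and `1 + t ≤ exp t` is used at `t = (q' - q)|z|²`. -/
lemma coord_mul (hf : GaussianBound q f) (h : q < q') (j : Fin n) :
    GaussianBound q' (creation j f) := by
  obtain ⟨C, hC0, hC⟩ := hf.exists_nonneg
  refine ⟨C * (1 + (q' - q)⁻¹), fun z => ?_⟩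
  have hd : 0 < q' - q := sub_pos.2 h
  have h1 : ‖z j‖ ≤ (1 + (q' - q)⁻¹) * Real.exp ((q' - q) * sqNorm z) := by
    have h2 := norm_sq_le_sqNorm z j
    have h3 := Real.add_one_le_exp ((q' - q) * sqNorm z)
    have h4 : ‖z j‖ ≤ 1 + ‖z j‖ ^ 2 := by nlinarith [sq_nonneg (‖z j‖ - 1), norm_nonneg (z j)]
    have h5 : 1 + sqNorm z ≤ (1 + (q' - q)⁻¹) * ((q' - q) * sqNorm z + 1) := by
      have := sqNorm_nonneg z
      have e : (1 + (q' - q)⁻¹) * ((q' - q) * sqNorm z + 1) =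
        1 + sqNorm z + (q' - q) * sqNorm z + (q' - q)⁻¹ := by field_simp; ring
      rw [e]
      have : 0 ≤ (q' - q) * sqNorm z := by positivity
      have : 0 ≤ (q' - q)⁻¹ := by positivity
      linarith
    calc _ ≤ 1 + sqNorm z := by linarith
      _ ≤ _ := h5
      _ ≤ _ := by gcongr
  have e : q' * sqNorm z = (q' - q) * sqNorm z + q * sqNorm z := by ring
  rw [creation, norm_mul, e, Real.exp_add]
  calc _ ≤ _ := mul_le_mul h1 (hC z) (norm_nonneg _) (by positivity)
    _ = _ := by ring

end GaussianBound

lemma sqNorm_add_le (z w : Fin n → ℂ) {ε : ℝ} (hε : 0 < ε) :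
    sqNorm (z + w) ≤ (1 + ε) * sqNorm z + (1 + ε⁻¹) * sqNorm w := by
  simp only [sqNorm, Finset.mul_sum, ← Finset.sum_add_distrib]
  refine Finset.sum_le_sum fun j _ => ?_
  have h1 : ‖(z + w) j‖ ^ 2 ≤ (‖z j‖ + ‖w j‖) ^ 2 := by
    gcongr; exact norm_add_le _ _
  have h2 : 2 * ‖z j‖ * ‖w j‖ ≤ ε * ‖z j‖ ^ 2 + ε⁻¹ * ‖w j‖ ^ 2 := by
    have := sq_nonneg (ε * ‖z j‖ - ‖w j‖)
    have h3 : 0 ≤ ε⁻¹ * (ε * ‖z j‖ - ‖w j‖) ^ 2 := by positivity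
    have h4 : ε⁻¹ * (ε * ‖z j‖ - ‖w j‖) ^ 2 =
      ε * ‖z j‖ ^ 2 + ε⁻¹ * ‖w j‖ ^ 2 - 2 * ‖z j‖ * ‖w j‖ := by field_simp; ring
    linarith
  nlinarith

lemma annihilation_eq_deriv {f : (Fin n → ℂ) → ℂ} (hf : Differentiable ℂ f) (j : Fin n)
    (z : Fin n → ℂ) :
    annihilation j f z = deriv (fun t : ℂ => f (z + t • Pi.single j 1)) 0 := by
  have h1 : HasDerivAt (fun t : ℂ => z + t • (Pi.single j 1 : Fin n → ℂ)) (Pi.single j 1) 0 := by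
    simpa using ((hasDerivAt_id (0 : ℂ)).smul_const (Pi.single j 1 : Fin n → ℂ)).const_add z
  have h2 : HasFDerivAt f (fderiv ℂ f z) (z + (0 : ℂ) • Pi.single j 1) := by
    simpa using (hf z).hasFDerivAt
  exact (h2.comp_hasDerivAt 0 h1).deriv.symm

/-- Cauchy's estimate on the unit circle in the `j`-th direction. Moving by a unit vector changes
`|z|²` to at most `(1 + ε)|z|²` plus a constant, and `ε` is chosen so that `q (1 + ε) = q'`. -/
lemma GaussianBound.annihilation {q q' : ℝ} {f : (Fin n → ℂ) → ℂ} (hf : GaussianBound q f)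
    (hd : Differentiable ℂ f) (hq : 0 < q) (h : q < q') (j : Fin n) :
    GaussianBound q' (annihilation j f) := by
  obtain ⟨C, hC0, hC⟩ := hf.exists_nonneg
  set ε := q' / q - 1 with hε'
  have hε : 0 < ε := by rw [hε', sub_pos, one_lt_div hq]; exact h
  have e : q * (1 + ε) = q' := by rw [hε']; field_simp; ring
  refine ⟨C * Real.exp (q * (1 + ε⁻¹)), fun z => ?_⟩
  rw [annihilation_eq_deriv hd]
  have hdd : Differentiable ℂ fun t : ℂ => f (z + t • Pi.single j 1) :=
    hd.comp (by fun_prop)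
  have := Complex.norm_deriv_le_of_forall_mem_sphere_norm_le (c := 0) one_pos
    (C := C * Real.exp (q * (1 + ε⁻¹)) * Real.exp (q' * sqNorm z))
    hdd.diffContOnCl (fun t ht => ?_)
  · simpa using this
  · refine (hC _).trans ?_
    rw [mul_assoc, ← Real.exp_add]
    gcongr
    have h1 := sqNorm_add_le z (t • Pi.single j 1) hε
    have h2 : sqNorm (t • (Pi.single j 1 : Fin n → ℂ)) = 1 := by
      have ht : ‖t‖ = 1 := by simpa using ht
      rw [sqNorm, Finset.sum_eq_single j]
      · simp [ht]
      · intro k _ hk; simp [hk]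
      · simp
    rw [h2] at h1
    rw [← e]
    nlinarith

lemma measurable_annihilation (f : (Fin n → ℂ) → ℂ) (j : Fin n) :
    Measurable (annihilation j f) :=
  measurable_fderiv_apply_const ℂ f _

lemma differentiable_creation {f : (Fin n → ℂ) → ℂ} (hd : Differentiable ℂ f) (j : Fin n) :
    Differentiable ℂ (creation j f) := by
  unfold creation; fun_prop

/-! ### Exponentials of quadratic polynomials -/

/-- `exp (½ z S z + z ℓ)`. -/
def quadExp (S : Matrix (Fin n) (Fin n) ℂ) (ℓ z : Fin n → ℂ) : ℂ :=
  Complex.exp (1 / 2 * (z ⬝ᵥ S *ᵥ z) + z ⬝ᵥ ℓ)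

lemma differentiable_quadExp (S : Matrix (Fin n) (Fin n) ℂ) (ℓ : Fin n → ℂ) :
    Differentiable ℂ (quadExp S ℓ) := by
  unfold quadExp dotProduct mulVec dotProduct
  fun_prop

/-- Completing the square shows that the linear term costs only an arbitrarily small `ε` in the
exponent, with a constant depending on `ℓ`. -/
lemma gaussianBound_quadExp {S : Matrix (Fin n) (Fin n) ℂ} {r q : ℝ}
    (h : ∀ z : Fin n → ℂ, ‖z ⬝ᵥ S *ᵥ z‖ ≤ r * sqNorm z) (hq : r / 2 < q) (ℓ : Fin n → ℂ) :
    GaussianBound q (quadExp S ℓ) := by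
  set ε := q - r / 2 with hε'
  have hε : 0 < ε := sub_pos.2 hq
  refine ⟨Real.exp ((4 * ε)⁻¹ * sqNorm ℓ), fun z => ?_⟩
  rw [quadExp, Complex.norm_exp, ← Real.exp_add]
  refine Real.exp_le_exp.2 ?_
  have h1 : (1 / 2 * (z ⬝ᵥ S *ᵥ z)).re ≤ r / 2 * sqNorm z := by
    refine (Complex.re_le_norm _).trans ?_
    rw [norm_mul]
    have := h z
    norm_num
    linarith
  have h2 : (z ⬝ᵥ ℓ).re ≤ ε * sqNorm z + (4 * ε)⁻¹ * sqNorm ℓ := by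
    refine (Complex.re_le_norm _).trans ((norm_sum_le _ _).trans ?_)
    simp only [sqNorm, Finset.mul_sum, ← Finset.sum_add_distrib]
    refine Finset.sum_le_sum fun j _ => ?_
    rw [norm_mul]
    have h3 : 0 ≤ ε⁻¹ * (ε * ‖z j‖ - ‖ℓ j‖ / 2) ^ 2 := by positivity
    have h4 : ε⁻¹ * (ε * ‖z j‖ - ‖ℓ j‖ / 2) ^ 2 =
      ε * ‖z j‖ ^ 2 + (4 * ε)⁻¹ * ‖ℓ j‖ ^ 2 - ‖z j‖ * ‖ℓ j‖ := by field_simp; ring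
    linarith
  rw [Complex.add_re]
  have e : q * sqNorm z = r / 2 * sqNorm z + ε * sqNorm z := by rw [hε']; ring
  linarith

lemma hasDerivAt_quadExp {S : Matrix (Fin n) (Fin n) ℂ} (hS : S.IsSymm) (ℓ z : Fin n → ℂ)
    (j : Fin n) :
    annihilation j (quadExp S ℓ) z = ((S *ᵥ z) j + ℓ j) * quadExp S ℓ z := by
  rw [annihilation_eq_deriv (differentiable_quadExp S ℓ)]
  refine HasDerivAt.deriv ?_
  -- On a complex line the exponent is a quadratic polynomial in `t`; symmetry of `S` merges its two
  -- cross terms.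
  have e : ∀ t : ℂ, quadExp S ℓ (z + t • Pi.single j 1) =
      quadExp S ℓ z * Complex.exp (t * ((S *ᵥ z) j + ℓ j) + t ^ 2 * (1 / 2 * S j j)) := by
    intro t
    have h1 : z ⬝ᵥ S.col j = (S *ᵥ z) j := by
      simp only [dotProduct, mulVec, Matrix.col_apply]
      exact Finset.sum_congr rfl fun i _ => by rw [mul_comm, hS.apply]
    rw [quadExp, quadExp, ← Complex.exp_add]
    congr 1
    simp only [mulVec_add, mulVec_smul, mulVec_single_one, add_dotProduct, dotProduct_add,
      smul_dotProduct, dotProduct_smul, single_one_dotProduct, h1, smul_eq_mul,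
      Matrix.col_apply]
    ring
  simp only [e]
  have h2 : HasDerivAt (fun t : ℂ => t * ((S *ᵥ z) j + ℓ j) + t ^ 2 * (1 / 2 * S j j))
      ((S *ᵥ z) j + ℓ j) 0 := by
    have := ((hasDerivAt_id (0 : ℂ)).mul_const ((S *ᵥ z) j + ℓ j)).fun_add
      ((hasDerivAt_pow 2 (0 : ℂ)).mul_const (1 / 2 * S j j))
    simpa using this
  have := (h2.cexp).const_mul (quadExp S ℓ z)
  simpa [mul_comm] using this

lemma fderiv_eq_zero_of_annihilation {f : (Fin n → ℂ) → ℂ} {z : Fin n → ℂ}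
    (h : ∀ j, annihilation j f z = 0) : fderiv ℂ f z = 0 := by
  refine ContinuousLinearMap.coe_injective (LinearMap.pi_ext' fun j => LinearMap.ext_ring ?_)
  simpa [annihilation] using h j

lemma annihilation_mul {f g : (Fin n → ℂ) → ℂ} (hf : Differentiable ℂ f)
    (hg : Differentiable ℂ g) (j : Fin n) (z : Fin n → ℂ) :
    annihilation j (fun z => f z * g z) z =
      annihilation j f z * g z + f z * annihilation j g z := by
  simp only [annihilation]
  rw [fderiv_fun_mul (hf z) (hg z)]
  simp
  ring

/-- A solution of `∂ⱼ g = (S z + ℓ)ⱼ g` is a multiple of `exp (½ z S z + z ℓ)`. -/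
lemma eq_const_mul_quadExp {S : Matrix (Fin n) (Fin n) ℂ} (hS : S.IsSymm) {ℓ : Fin n → ℂ}
    {g : (Fin n → ℂ) → ℂ} (hg : Differentiable ℂ g)
    (h : ∀ j z, annihilation j g z = ((S *ᵥ z) j + ℓ j) * g z) (z : Fin n → ℂ) :
    g z = g 0 * quadExp S ℓ z := by
  have hneg : ∀ z, quadExp S ℓ z * quadExp (-S) (-ℓ) z = 1 := by
    intro z
    rw [quadExp, quadExp, ← Complex.exp_add, ← Complex.exp_zero]
    congr 1
    simp only [neg_mulVec, dotProduct_neg]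
    ring
  have hd := differentiable_quadExp (-S) (-ℓ)
  have hS' : (-S).IsSymm := by simp [Matrix.IsSymm, hS.eq]
  -- The product of `g` with the reciprocal of the candidate solution has zero derivative.
  have hc := is_const_of_fderiv_eq_zero (hg.mul hd) (fun z => fderiv_eq_zero_of_annihilation
    fun j => (annihilation_mul hg hd j z).trans (by
      rw [h, hasDerivAt_quadExp hS', neg_mulVec]; simp only [Pi.neg_apply]; ring)) z 0
  have h0 : quadExp (-S) (-ℓ) 0 = 1 := by simp [quadExp]
  simp only [Pi.mul_apply, h0, mul_one] at hc
  rw [← hc, mul_assoc, mul_comm (quadExp (-S) (-ℓ) z), hneg, mul_one]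

/-! ### Mean value property and reproducing kernel -/

lemma ofReal_sqNorm (u : Fin n → ℂ) : (sqNorm u : ℂ) = star u ⬝ᵥ u := by
  simp [sqNorm, dotProduct, Complex.conj_mul']

lemma ofReal_weight (u : Fin n → ℂ) :
    (weight u : ℂ) = ((Real.pi : ℂ) ^ n)⁻¹ * Complex.exp (-(star u ⬝ᵥ u)) := by
  rw [weight_eq, ← ofReal_sqNorm]; push_cast; rfl

lemma measurePreserving_smul {c : ℂ} (hc : ‖c‖ = 1) :
    MeasurePreserving (fun u : Fin n → ℂ => c • u) := by
  have h1 : MeasurePreserving (fun z : ℂ => c * z) := by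
    have := (rotation ⟨c, by simpa [Submonoid.unitSphere] using hc⟩).measurePreserving
    exact this
  exact volume_preserving_pi (f := fun (_ : Fin n) (z : ℂ) => c * z) fun _ => h1

lemma weight_smul {c : ℂ} (hc : ‖c‖ = 1) (u : Fin n → ℂ) : weight (c • u) = weight u := by
  simp [weight, hc]

lemma measurableEmbedding_smul {c : ℂ} (hc : ‖c‖ = 1) :
    MeasurableEmbedding (fun u : Fin n → ℂ => c • u) :=
  (Homeomorph.smulOfNeZero c (by rintro rfl; simp at hc)).measurableEmbedding

lemma integral_comp_smul_bargmannMeasure {c : ℂ} (hc : ‖c‖ = 1) (g : (Fin n → ℂ) → ℂ) :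
    ∫ u, g (c • u) ∂(bargmannMeasure n) = ∫ u, g u ∂(bargmannMeasure n) := by
  rw [integral_bargmannMeasure, integral_bargmannMeasure]
  have := (measurePreserving_smul hc).integral_comp (measurableEmbedding_smul hc)
    (fun u : Fin n → ℂ => (weight u : ℂ) * g u)
  simpa only [weight_smul hc] using this

lemma integrable_comp_smul_bargmannMeasure {c : ℂ} (hc : ‖c‖ = 1) {g : (Fin n → ℂ) → ℂ}
    (hg : Integrable g (bargmannMeasure n)) :
    Integrable (fun u => g (c • u)) (bargmannMeasure n) := by
  rw [integrable_bargmannMeasure_iff] at hg ⊢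
  have := ((measurePreserving_smul hc).integrable_comp_emb (measurableEmbedding_smul hc)
    (g := fun u : Fin n → ℂ => (weight u : ℂ) * g u)).2 hg
  simpa only [Function.comp_def, weight_smul hc] using this

instance : IsProbabilityMeasure (bargmannMeasure n) := by
  constructor
  rw [bargmannMeasure_eq, withDensity_apply _ MeasurableSet.univ, Measure.restrict_univ,
    ← ofReal_integral_eq_lintegral_ofReal, integral_weight, ENNReal.ofReal_one]
  · by_contra h
    have := integral_undef h
    rw [integral_weight] at this
    exact one_ne_zero this
  · exact Filter.Eventually.of_forall fun u => (weight_pos u).le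

/-- The measure is invariant under `u ↦ exp (-iθ) u`, so the integral equals its average over `θ`.
By Fubini the average may be taken first, and there it is the mean of the entire function `t ↦ f (t
ū)` over the unit circle. -/
lemma integral_eq_apply_zero {f : (Fin n → ℂ) → ℂ} (hf : Differentiable ℂ f)
    (hi : Integrable (fun u => f (star u)) (bargmannMeasure n)) :
    ∫ u, f (star u) ∂(bargmannMeasure n) = f 0 := by
  set μθ : Measure ℝ := volume.restrict (Set.Ioc 0 (2 * Real.pi)) with hμθ
  have hnorm : ∀ θ : ℝ, ‖Complex.exp (-(θ * Complex.I))‖ = 1 := fun θ => by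
    rw [← neg_mul, ← Complex.ofReal_neg, Complex.norm_exp_ofReal_mul_I]
  have hstar : ∀ (θ : ℝ) (u : Fin n → ℂ),
      f (star (Complex.exp (-(θ * Complex.I)) • u)) = f (circleMap 0 1 θ • star u) := by
    intro θ u
    rw [star_smul, Complex.star_def, ← Complex.exp_conj]
    simp [circleMap]
  have hint : Integrable (Function.uncurry fun (θ : ℝ) (u : Fin n → ℂ) =>
      f (circleMap 0 1 θ • star u)) (μθ.prod (bargmannMeasure n)) := by
    have hmeas : Continuous (Function.uncurry fun (θ : ℝ) (u : Fin n → ℂ) =>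
      f (circleMap 0 1 θ • star u)) := by
      refine hf.continuous.comp ?_
      exact ((continuous_circleMap 0 1).comp continuous_fst).smul
        (continuous_star.comp continuous_snd)
    rw [integrable_prod_iff hmeas.aestronglyMeasurable]
    refine ⟨Filter.Eventually.of_forall fun θ => ?_, ?_⟩
    · have := integrable_comp_smul_bargmannMeasure (hnorm θ) hi
      simp only [hstar] at this
      exact this
    · have : ∀ θ : ℝ, ∫ u, ‖f (circleMap 0 1 θ • star u)‖ ∂(bargmannMeasure n) =
          ∫ u, ‖f (star u)‖ ∂(bargmannMeasure n) := by
        intro θ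
        have := integral_comp_smul_bargmannMeasure (hnorm θ) (fun u => (‖f (star u)‖ : ℂ))
        simp only [hstar, integral_complex_ofReal] at this
        exact_mod_cast this
      simp only [Function.uncurry, this]
      exact integrable_const _
  have hswap := integral_integral_swap hint
  have h1 : ∀ θ : ℝ, ∫ u, f (circleMap 0 1 θ • star u) ∂(bargmannMeasure n) =
      ∫ u, f (star u) ∂(bargmannMeasure n) := by
    intro θ
    have := integral_comp_smul_bargmannMeasure (hnorm θ) (fun u => f (star u))
    simpa only [hstar] using this
  have h2 : ∀ u : Fin n → ℂ, ∫ θ, f (circleMap 0 1 θ • star u) ∂μθ = 2 * Real.pi * f 0 := by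
    intro u
    have hd : Differentiable ℂ fun t : ℂ => f (t • star u) := hf.comp (by fun_prop)
    have := (hd.diffContOnCl (s := Metric.ball 0 |1|)).circleAverage
    rw [Real.circleAverage_def, intervalIntegral.integral_of_le (by positivity)] at this
    simp only [zero_smul] at this
    rw [← this, Complex.real_smul, ← mul_assoc]
    push_cast
    rw [mul_inv_cancel₀ (by simp [Real.pi_ne_zero]), one_mul]
  simp only [h1, h2, integral_const, probReal_univ, one_smul] at hswap
  have hreal : μθ.real Set.univ = 2 * Real.pi := by
    simp [hμθ, Measure.real, Real.pi_pos.le]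
  rw [hreal, Complex.real_smul] at hswap
  push_cast at hswap
  exact mul_left_cancel₀ (by simp [Real.pi_ne_zero]) hswap

/-- The reproducing property of the Gaussian measure. -/
lemma integral_exp_mul_eq_apply {f : (Fin n → ℂ) → ℂ} (hf : Differentiable ℂ f) (z : Fin n → ℂ)
    (hi : Integrable (fun u => Complex.exp (u ⬝ᵥ z) * f (star u)) (bargmannMeasure n)) :
    ∫ u, Complex.exp (u ⬝ᵥ z) * f (star u) ∂(bargmannMeasure n) = f z := by
  -- Translating the Gaussian by `z̄` reduces the claim to the mean value property at `0`; the
  -- exponential factor in `g` compensates the change of the weight.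
  set g : (Fin n → ℂ) → ℂ := fun w => f (w + z) * Complex.exp (-(w ⬝ᵥ star z)) with hg
  have hgd : Differentiable ℂ g := by
    refine (hf.comp (by fun_prop)).mul ?_
    unfold dotProduct; fun_prop
  have key : ∀ v : Fin n → ℂ, (weight (v - star z) : ℂ) * g (star (v - star z)) =
      (weight v : ℂ) * (Complex.exp (v ⬝ᵥ z) * f (star v)) := by
    intro v
    simp only [hg, star_sub, star_star, sub_add_cancel, ofReal_weight]
    have : Complex.exp (-((star v - z) ⬝ᵥ (v - star z))) *
        Complex.exp (-((star v - z) ⬝ᵥ star z)) =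
        Complex.exp (-(star v ⬝ᵥ v)) * Complex.exp (v ⬝ᵥ z) := by
      rw [← Complex.exp_add, ← Complex.exp_add]
      congr 1
      simp only [sub_dotProduct, dotProduct_sub, dotProduct_comm z v]
      ring
    linear_combination ((Real.pi : ℂ) ^ n)⁻¹ * f (star v) * this
  have h1 : Integrable (fun u => g (star u)) (bargmannMeasure n) := by
    rw [integrable_bargmannMeasure_iff] at hi ⊢
    have := hi.comp_add_right (star z)
    refine this.congr (Filter.Eventually.of_forall fun u => ?_)
    simpa using (key (u + star z)).symm
  have h2 := integral_eq_apply_zero hgd h1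
  have h0 : g 0 = f z := by simp [hg]
  rw [h0] at h2
  rw [← h2, integral_bargmannMeasure, integral_bargmannMeasure,
    ← integral_sub_right_eq_self (fun u => (weight u : ℂ) * g (star u)) (star z)]
  exact integral_congr_ae (Filter.Eventually.of_forall fun v => (key v).symm)

/-! ### Coherent vectors -/

lemma norm_zero_dotProduct (z : Fin n → ℂ) :
    ‖z ⬝ᵥ (0 : Matrix (Fin n) (Fin n) ℂ) *ᵥ z‖ ≤ 0 * sqNorm z := by simp

/-- The vector given by an element of `bargmannSubmodule`. -/
def ofMem (f : (Fin n → ℂ) → ℂ) (hf : f ∈ bargmannSubmodule n) : BargmannSpace n := ⟨f, hf⟩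

lemma ofMem_apply (f : (Fin n → ℂ) → ℂ) (hf : f ∈ bargmannSubmodule n) (z : Fin n → ℂ) :
    ofMem f hf z = f z := rfl

/-- The coherent vector `z ↦ exp (z p)`. -/
def coherent (p : Fin n → ℂ) : BargmannSpace n :=
  ofMem (quadExp 0 p) <| (gaussianBound_quadExp (q := 1 / 4) norm_zero_dotProduct
    (by norm_num) p).mem (by norm_num) (differentiable_quadExp _ _)

lemma coherent_apply (p z : Fin n → ℂ) : coherent p z = Complex.exp (z ⬝ᵥ p) := by
  simp [coherent, ofMem_apply, quadExp]

lemma inner_eq (f g : BargmannSpace n) :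
    inner ℂ f g = ∫ u, star (f (star u)) * g (star u) ∂(bargmannMeasure n) := rfl

lemma star_coherent (p u : Fin n → ℂ) :
    star (coherent p (star u)) = Complex.exp (u ⬝ᵥ star p) := by
  rw [coherent_apply, Complex.star_def, ← Complex.exp_conj]
  simp [dotProduct]

lemma inner_coherent (p : Fin n → ℂ) (f : BargmannSpace n) :
    inner ℂ (coherent p) f = f (star p) := by
  have := BargmannSpace.integrable_inner (coherent p) f
  rw [inner_eq]
  simp only [star_coherent] at this ⊢
  exact integral_exp_mul_eq_apply f.2.1 _ this

lemma apply_eq_integral (f : BargmannSpace n) (z : Fin n → ℂ) :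
    f z = ∫ u, Complex.exp (u ⬝ᵥ z) * f (star u) ∂(bargmannMeasure n) := by
  have := inner_coherent (star z) f
  simpa [inner_eq, star_coherent] using this.symm

lemma norm_coherent_sq (p : Fin n → ℂ) : ‖coherent p‖ ^ 2 = Real.exp (sqNorm p) := by
  rw [norm_sq_eq_re_inner (𝕜 := ℂ), inner_coherent, coherent_apply, ← ofReal_sqNorm,
    ← Complex.ofReal_exp]
  exact Complex.ofReal_re _

lemma norm_coherent (p : Fin n → ℂ) : ‖coherent p‖ = Real.exp (1 / 2 * sqNorm p) := by
  rw [← sq_eq_sq₀ (norm_nonneg _) (Real.exp_pos _).le, norm_coherent_sq, ← Real.exp_nat_mul]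
  congr 1; push_cast; ring

/-- Cauchy–Schwarz against the coherent vector at `z̄`, whose norm is `exp (½|z|²)`. -/
lemma gaussianBound_coe (f : BargmannSpace n) : GaussianBound (1 / 2) f := by
  refine ⟨‖f‖, fun z => ?_⟩
  have := norm_inner_le_norm (𝕜 := ℂ) (coherent (star z)) f
  rwa [inner_coherent, star_star, norm_coherent, sqNorm_star, mul_comm] at this

lemma coe_ext {f g : BargmannSpace n} (h : ∀ z, f z = g z) : f = g := Subtype.ext (funext h)

/-! ### Laplace transforms -/

/-- `h` is integrable against exponentials of linear functions. -/
structure ExpIntegrable (h : (Fin n → ℂ) → ℂ) : Prop where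
  aestronglyMeasurable : AEStronglyMeasurable h (bargmannMeasure n)
  integrable : ∀ M : ℝ, Integrable (fun u => ‖h u‖ * Real.exp (M * ∑ j, ‖u j‖)) (bargmannMeasure n)

lemma norm_exp_dotProduct_le {w : Fin n → ℂ} {M : ℝ} (hw : ∀ j, ‖w j‖ ≤ M) (u : Fin n → ℂ) :
    ‖Complex.exp (u ⬝ᵥ w)‖ ≤ Real.exp (M * ∑ j, ‖u j‖) := by
  rw [Complex.norm_exp]
  refine Real.exp_le_exp.2 ((Complex.re_le_norm _).trans ((norm_sum_le _ _).trans ?_))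
  rw [Finset.mul_sum]
  refine Finset.sum_le_sum fun j _ => ?_
  rw [norm_mul, mul_comm]
  exact mul_le_mul_of_nonneg_right (hw j) (norm_nonneg _)

lemma gaussianBound_exp_sum (M : ℝ) {q : ℝ} (hq : 0 < q) :
    GaussianBound q (fun u : Fin n → ℂ => (Real.exp (M * ∑ j, ‖u j‖) : ℂ)) := by
  refine ⟨Real.exp (∑ _j : Fin n, (4 * q)⁻¹ * M ^ 2), fun u => ?_⟩
  rw [← Real.exp_add, Complex.norm_real, Real.norm_of_nonneg
    (Real.exp_pos _).le]
  refine Real.exp_le_exp.2 ?_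
  simp only [sqNorm, Finset.mul_sum, ← Finset.sum_add_distrib]
  refine Finset.sum_le_sum fun j _ => ?_
  have h3 : 0 ≤ q⁻¹ * (q * ‖u j‖ - M / 2) ^ 2 := by positivity
  have h4 : q⁻¹ * (q * ‖u j‖ - M / 2) ^ 2 =
    q * ‖u j‖ ^ 2 + (4 * q)⁻¹ * M ^ 2 - M * ‖u j‖ := by field_simp; ring
  linarith

lemma GaussianBound.expIntegrable {q : ℝ} {h : (Fin n → ℂ) → ℂ} (hh : GaussianBound q h)
    (hq : q < 1) (hm : Measurable h) : ExpIntegrable h := by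
  refine ⟨hm.aestronglyMeasurable, fun M => ?_⟩
  have := ((hh.mul (gaussianBound_exp_sum M (q := (1 - q) / 2) (by linarith))).integrable
    (by linarith) (hm.mul (Continuous.measurable (by fun_prop)))).norm
  refine this.congr (Filter.Eventually.of_forall fun u => ?_)
  simp only [norm_mul, Complex.norm_real, Real.norm_of_nonneg (Real.exp_pos _).le]

lemma MemLp.expIntegrable {h : (Fin n → ℂ) → ℂ} (hh : MemLp h 2 (bargmannMeasure n)) :
    ExpIntegrable h := by
  refine ⟨hh.aestronglyMeasurable, fun M => ?_⟩
  refine MemLp.integrable_mul (p := 2) (q := 2) hh.norm ?_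
  have hc : Continuous fun u : Fin n → ℂ => Real.exp (M * ∑ j, ‖u j‖) := by fun_prop
  rw [memLp_two_iff_integrable_sq hc.aestronglyMeasurable]
  have := (((gaussianBound_exp_sum (n := n) (2 * M) (q := 1 / 2) (by norm_num))).integrable
    (by norm_num) (Continuous.measurable (by fun_prop))).norm
  refine this.congr (Filter.Eventually.of_forall fun u => ?_)
  simp only [Complex.norm_real, Real.norm_of_nonneg (Real.exp_pos _).le]
  rw [← Real.exp_nat_mul]
  congr 1; push_cast; ring

namespace ExpIntegrable

variable {h : (Fin n → ℂ) → ℂ}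

lemma integrable_mul_exp (hh : ExpIntegrable h) (w : Fin n → ℂ) :
    Integrable (fun u => h u * Complex.exp (u ⬝ᵥ w)) (bargmannMeasure n) := by
  refine (hh.integrable ‖w‖).mono'
    (hh.aestronglyMeasurable.mul (Continuous.aestronglyMeasurable (by fun_prop)))
    (Filter.Eventually.of_forall fun u => ?_)
  rw [norm_mul]
  gcongr
  exact norm_exp_dotProduct_le (norm_le_pi_norm w) u

/-- Multiplication by `u` as a linear form. -/
def dotCLM (u : Fin n → ℂ) : (Fin n → ℂ) →L[ℂ] ℂ :=
  ∑ j, u j • ContinuousLinearMap.proj (R := ℂ) (φ := fun _ : Fin n => ℂ) j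

lemma dotCLM_apply (u w : Fin n → ℂ) : dotCLM u w = u ⬝ᵥ w := by
  simp [dotCLM, dotProduct]

lemma norm_dotCLM_le (u : Fin n → ℂ) : ‖dotCLM u‖ ≤ ∑ j, ‖u j‖ := by
  refine ContinuousLinearMap.opNorm_le_bound _ (by positivity) fun w => ?_
  rw [dotCLM_apply, dotProduct, Finset.sum_mul]
  refine (norm_sum_le _ _).trans (Finset.sum_le_sum fun j _ => ?_)
  rw [norm_mul]
  gcongr
  exact norm_le_pi_norm w j

lemma continuous_dotCLM : Continuous (dotCLM : (Fin n → ℂ) → _) := by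
  unfold dotCLM; fun_prop

lemma norm_bound (hM : ℝ) {w : Fin n → ℂ} (hw : ∀ j, ‖w j‖ ≤ hM) (u : Fin n → ℂ) :
    ‖(h u * Complex.exp (u ⬝ᵥ w)) • dotCLM u‖ ≤ ‖h u‖ * Real.exp ((hM + 1) * ∑ j, ‖u j‖) := by
  rw [norm_smul, norm_mul, add_mul, Real.exp_add, one_mul, mul_assoc]
  gcongr
  · exact norm_exp_dotProduct_le hw u
  · exact (norm_dotCLM_le u).trans (by linarith [Real.add_one_le_exp (∑ j, ‖u j‖)])

lemma hasFDerivAt (hh : ExpIntegrable h) (w : Fin n → ℂ) :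
    Integrable (fun u => (h u * Complex.exp (u ⬝ᵥ w)) • dotCLM u) (bargmannMeasure n) ∧
    HasFDerivAt (fun w => ∫ u, h u * Complex.exp (u ⬝ᵥ w) ∂(bargmannMeasure n))
      (∫ u, (h u * Complex.exp (u ⬝ᵥ w)) • dotCLM u ∂(bargmannMeasure n)) w := by
  have hm : AEStronglyMeasurable (fun u => (h u * Complex.exp (u ⬝ᵥ w)) • dotCLM u)
      (bargmannMeasure n) :=
    (hh.integrable_mul_exp w).aestronglyMeasurable.smul continuous_dotCLM.aestronglyMeasurable
  refine ⟨(hh.integrable (‖w‖ + 1)).mono' hm (Filter.Eventually.of_forall fun u =>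
    norm_bound _ (norm_le_pi_norm w) u), ?_⟩
  -- On the unit ball around `w` the exponential rate is at most `‖w‖ + 1`; one further unit absorbs
  -- the factor `dotCLM u`.
  have hb : ∀ u : Fin n → ℂ, ∀ x ∈ Metric.ball w 1,
      ‖(h u * Complex.exp (u ⬝ᵥ x)) • dotCLM u‖ ≤
        ‖h u‖ * Real.exp ((‖w‖ + 1 + 1) * ∑ j, ‖u j‖) := by
    intro u x hx
    refine norm_bound _ (fun j => ?_) u
    have h1 := norm_le_pi_norm x j
    have h2 : ‖x - w‖ < 1 := by simpa [dist_eq_norm] using hx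
    have h3 := norm_sub_norm_le x w
    linarith
  have hd : ∀ u x : Fin n → ℂ, HasFDerivAt (fun x => h u * Complex.exp (u ⬝ᵥ x))
      ((h u * Complex.exp (u ⬝ᵥ x)) • dotCLM u) x := by
    intro u x
    have h1 : HasFDerivAt (fun x => dotCLM u x) (dotCLM u) x := (dotCLM u).hasFDerivAt
    simp only [dotCLM_apply] at h1
    have := (h1.cexp).const_mul (h u)
    rwa [smul_smul] at this
  exact hasFDerivAt_integral_of_dominated_of_fderiv_le (𝕜 := ℂ)
    (F := fun x u => h u * Complex.exp (u ⬝ᵥ x))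
    (F' := fun x u => (h u * Complex.exp (u ⬝ᵥ x)) • dotCLM u) (Metric.ball_mem_nhds w one_pos)
    (Filter.Eventually.of_forall fun w => (hh.integrable_mul_exp w).aestronglyMeasurable)
    (hh.integrable_mul_exp w) hm (Filter.Eventually.of_forall hb) (hh.integrable _)
    (Filter.Eventually.of_forall fun u x _ => hd u x)

lemma differentiable (hh : ExpIntegrable h) :
    Differentiable ℂ (fun w => ∫ u, h u * Complex.exp (u ⬝ᵥ w) ∂(bargmannMeasure n)) :=
  fun w => (hh.hasFDerivAt w).2.differentiableAt

lemma integrable_coord (hh : ExpIntegrable h) (w : Fin n → ℂ) (j : Fin n) :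
    Integrable (fun u => u j * (h u * Complex.exp (u ⬝ᵥ w))) (bargmannMeasure n) := by
  have := (hh.hasFDerivAt w).1.apply_continuousLinearMap (Pi.single j 1)
  refine this.congr (Filter.Eventually.of_forall fun u => ?_)
  simp [dotCLM_apply, mul_comm]

lemma annihilation_eq (hh : ExpIntegrable h) (w : Fin n → ℂ) (j : Fin n) :
    annihilation j (fun w => ∫ u, h u * Complex.exp (u ⬝ᵥ w) ∂(bargmannMeasure n)) w =
      ∫ u, u j * (h u * Complex.exp (u ⬝ᵥ w)) ∂(bargmannMeasure n) := by
  rw [annihilation, (hh.hasFDerivAt w).2.fderiv,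
    ContinuousLinearMap.integral_apply (hh.hasFDerivAt w).1]
  refine integral_congr_ae (Filter.Eventually.of_forall fun u => ?_)
  simp [dotCLM_apply, mul_comm]

end ExpIntegrable

/-! ### Integration by parts -/

lemma hasDerivAt_line {f : (Fin n → ℂ) → ℂ} (hf : Differentiable ℂ f) (j : Fin n)
    (z : Fin n → ℂ) :
    HasDerivAt (fun t : ℂ => f (z + t • Pi.single j 1)) (annihilation j f z) 0 := by
  rw [annihilation_eq_deriv hf]
  exact (hf.comp (f := fun t : ℂ => z + t • Pi.single j 1)
    (by fun_prop)).differentiableAt.hasDerivAt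

lemma hasDerivAt_real_line {f : (Fin n → ℂ) → ℂ} (hf : Differentiable ℂ f) (j : Fin n)
    (z : Fin n → ℂ) (c : ℂ) :
    HasDerivAt (fun t : ℝ => f (z + (t * c) • Pi.single j 1)) (c * annihilation j f z) 0 := by
  have h1 : HasDerivAt (fun t : ℂ => t * c) c ((0 : ℝ) : ℂ) := by
    simpa using (hasDerivAt_id (0 : ℂ)).mul_const c
  have h2 : HasDerivAt (fun t : ℂ => f (z + t • Pi.single j 1)) (annihilation j f z)
      (((0 : ℝ) : ℂ) * c) := by simpa using hasDerivAt_line hf j z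
  have := (HasDerivAt.comp ((0 : ℝ) : ℂ) (h := fun t : ℂ => t * c) h2 h1).comp_ofReal
  simpa [mul_comm] using this

lemma hasLineDerivAt_weight (j : Fin n) (u : Fin n → ℂ) (c : ℂ) :
    HasLineDerivAt ℝ (fun u : Fin n → ℂ => (weight u : ℂ))
      (-(star c * u j + c * star (u j)) * weight u) u (Pi.single j c) := by
  have e : ∀ t : ℝ, (weight (u + t • (Pi.single j c : Fin n → ℂ)) : ℂ) = weight u * Complex.exp
      (t * -(star c * u j + c * star (u j)) + t ^ 2 * -(star c * c)) := by
    intro t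
    rw [ofReal_weight, ofReal_weight, mul_assoc, ← Complex.exp_add]
    congr 2
    have h1 : (t • Pi.single j c : Fin n → ℂ) = (t : ℂ) • Pi.single j c := by
      ext k; simp
    have h2 : star (Pi.single j c : Fin n → ℂ) = Pi.single j (star c) := by
      ext k; by_cases hk : k = j
      · subst hk; simp
      · simp [hk]
    rw [h1]
    simp only [star_add, star_smul, h2, add_dotProduct, dotProduct_add, smul_dotProduct,
      dotProduct_smul, single_dotProduct, dotProduct_single, smul_eq_mul, Pi.add_apply, Pi.smul_apply,
      Pi.star_apply,
      Complex.star_def, Complex.conj_ofReal, Pi.single_eq_same]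
    ring
  unfold HasLineDerivAt
  simp only [e]
  set A : ℂ := -(star c * u j + c * star (u j))
  have h2 : HasDerivAt (fun t : ℂ => t * A + t ^ 2 * -(star c * c)) A ((0 : ℝ) : ℂ) := by
    have := ((hasDerivAt_id (0 : ℂ)).mul_const A).fun_add
      ((hasDerivAt_pow 2 (0 : ℂ)).mul_const (-(star c * c)))
    simpa using this
  have := ((h2.cexp).const_mul (weight u : ℂ)).comp_ofReal
  simpa [mul_comm] using this

lemma integrable_of_gaussianBound {p q : ℝ} {G f : (Fin n → ℂ) → ℂ} (hG : GaussianBound p G)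
    (hf : GaussianBound q f) (hpq : p + q < 1) (hGm : Measurable G) (hfm : Measurable f) :
    Integrable (fun u => G u * f (star u)) (bargmannMeasure n) :=
  (hG.mul hf.comp_star).integrable hpq (hGm.mul (hfm.comp continuous_star.measurable))

/-- Real integration by parts in the directions `e_j` and `i e_j`. In the combination that forms
`∂/∂ū_j` the holomorphic factor `G` contributes nothing, and the derivative of the weight produces
`u_j`. -/
lemma integral_mul_annihilation {p q : ℝ} (hp : 0 < p) (hq : 0 < q) (hpq : p + q < 1)
    {G f : (Fin n → ℂ) → ℂ} (hGd : Differentiable ℂ G) (hfd : Differentiable ℂ f)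
    (hG : GaussianBound p G) (hf : GaussianBound q f) (j : Fin n) :
    ∫ u, G u * annihilation j f (star u) ∂(bargmannMeasure n) =
      ∫ u, u j * G u * f (star u) ∂(bargmannMeasure n) := by
  -- Half of the slack, so that either factor may lose `ε` in its exponent and the product remains
  -- integrable.
  set ε := (1 - (p + q)) / 2 with hε
  have hε0 : 0 < ε := by rw [hε]; linarith
  have i1 := integrable_of_gaussianBound (hG.annihilation hGd hp (lt_add_of_pos_right p hε0) j)
    hf (by linarith) (measurable_annihilation _ _) hfd.continuous.measurable
  have i2 := integrable_of_gaussianBound hG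
    (hf.annihilation hfd hq (lt_add_of_pos_right q hε0) j) (by linarith)
    hGd.continuous.measurable (measurable_annihilation _ _)
  have i3 := integrable_of_gaussianBound (hG.coord_mul (lt_add_of_pos_right p hε0) j)
    hf (by linarith) (differentiable_creation hGd j).continuous.measurable
    hfd.continuous.measurable
  have i4 := integrable_of_gaussianBound hG
    (hf.coord_mul (lt_add_of_pos_right q hε0) j) (by linarith) hGd.continuous.measurable
    (differentiable_creation hfd j).continuous.measurable
  have i5 := integrable_of_gaussianBound hG hf hpq hGd.continuous.measurable
    hfd.continuous.measurable
  have main : ∀ c : ℂ, star c * ∫ u, G u * annihilation j f (star u) ∂(bargmannMeasure n) =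
      -(c * (∫ u, annihilation j G u * f (star u) ∂(bargmannMeasure n)) -
        (star c * ∫ u, u j * G u * f (star u) ∂(bargmannMeasure n)) -
        c * ∫ u, G u * (star (u j) * f (star u)) ∂(bargmannMeasure n)) := by
    intro c
    have e : ∀ u, (c * annihilation j G u * weight u +
        G u * (-(star c * u j + c * star (u j)) * weight u)) * f (star u) =
        weight u * (c * (annihilation j G u * f (star u)) - star c * (u j * G u * f (star u)) -
        c * (G u * (star (u j) * f (star u)))) := fun u => by ring
    have e' : ∀ u, G u * weight u * (star c * annihilation j f (star u)) =
        weight u * (star c * (G u * annihilation j f (star u))) := fun u => by ring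
    have hint := ((i1.const_mul c).sub (i3.const_mul (star c))).sub (i4.const_mul c)
    have := integral_bilinear_hasLineDerivAt_right_eq_neg_left_of_integrable
      (μ := (volume : Measure (Fin n → ℂ))) (v := Pi.single j c)
      (f := fun u => G u * weight u) (g := fun u => f (star u))
      (f' := fun u => c * annihilation j G u * weight u +
        G u * (-(star c * u j + c * star (u j)) * weight u))
      (g' := fun u => star c * annihilation j f (star u))
      (B := ContinuousLinearMap.mul ℝ ℂ)
      ?_ ?_ ?_ ?_ ?_
    · simp only [ContinuousLinearMap.mul_apply', e, e'] at this
      rw [← integral_bargmannMeasure, ← integral_bargmannMeasure, integral_const_mul] at this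
      rw [this, integral_sub, integral_sub, integral_const_mul, integral_const_mul,
        integral_const_mul]
      · exact i1.const_mul _
      · exact i3.const_mul _
      · exact (i1.const_mul _).sub (i3.const_mul _)
      · exact i4.const_mul _
    · simp only [ContinuousLinearMap.mul_apply', e]
      exact integrable_bargmannMeasure_iff.1 hint
    · simp only [ContinuousLinearMap.mul_apply', e']
      exact integrable_bargmannMeasure_iff.1 (i2.const_mul _)
    · refine (integrable_bargmannMeasure_iff.1 i5).congr (Filter.Eventually.of_forall fun u => ?_)
      simp only [ContinuousLinearMap.mul_apply']
      ring
    · intro u _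
      have h1 := hasDerivAt_real_line hGd j u c
      have h2 := hasLineDerivAt_weight j u c
      have h3 : ∀ t : ℝ, (t * c) • (Pi.single j 1 : Fin n → ℂ) = t • Pi.single j c := by
        intro t; ext k; by_cases hk : k = j
        · subst hk; simp
        · simp [hk]
      unfold HasLineDerivAt at h2 ⊢
      simp only [h3] at h1
      simpa using h1.fun_mul h2
    · intro u _
      have h1 := hasDerivAt_real_line hfd j (star u) (star c)
      have h3 : ∀ t : ℝ, star u + (t * star c) • (Pi.single j 1 : Fin n → ℂ) =
          star (u + t • (Pi.single j c : Fin n → ℂ)) := by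
        intro t; ext k; by_cases hk : k = j
        · subst hk; simp
        · simp [hk]
      simp only [h3] at h1
      exact h1
  have m1 := main 1
  have mI := main Complex.I
  simp only [star_one, Complex.star_def, Complex.conj_I] at m1 mI
  have h2 : (2 : ℂ) ≠ 0 := two_ne_zero
  -- Adding `i` times the relation for `c = i` to the one for `c = 1` cancels the terms with `∂G`
  -- and with `ū_j` and doubles the two that remain.
  refine mul_left_cancel₀ h2 ?_
  linear_combination m1 + Complex.I * mI + (∫ u, G u * annihilation j f (star u)
    ∂(bargmannMeasure n) - (∫ u, annihilation j G u * f (star u) ∂(bargmannMeasure n)) -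
    (∫ u, u j * G u * f (star u) ∂(bargmannMeasure n)) +
    ∫ u, G u * ((starRingEnd ℂ) (u j) * f (star u)) ∂(bargmannMeasure n)) * Complex.I_sq

lemma integral_comp_star_bargmannMeasure (g : (Fin n → ℂ) → ℂ) :
    ∫ u, g (star u) ∂(bargmannMeasure n) = ∫ u, g u ∂(bargmannMeasure n) := by
  rw [integral_bargmannMeasure, integral_bargmannMeasure]
  have h1 : MeasurePreserving (fun u : Fin n → ℂ => star u) :=
    volume_preserving_pi (f := fun (_ : Fin n) (z : ℂ) => star z)
      fun _ => Complex.conjLIE.measurePreserving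
  have h2 : MeasurableEmbedding (fun u : Fin n → ℂ => star u) :=
    (Homeomorph.mk (Equiv.mk star star star_star star_star) continuous_star
      continuous_star).measurableEmbedding
  have := h1.integral_comp h2 (fun u : Fin n → ℂ => (weight u : ℂ) * g u)
  simpa [weight] using this

/-- The substitution `u ↦ ū` exchanges the roles of `G` and `f` in `integral_mul_annihilation`. -/
lemma integral_mul_creation {p q : ℝ} (hp : 0 < p) (hq : 0 < q) (hpq : p + q < 1)
    {G f : (Fin n → ℂ) → ℂ} (hGd : Differentiable ℂ G) (hfd : Differentiable ℂ f)
    (hG : GaussianBound p G) (hf : GaussianBound q f) (j : Fin n) :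
    ∫ u, G u * creation j f (star u) ∂(bargmannMeasure n) =
      ∫ u, annihilation j G u * f (star u) ∂(bargmannMeasure n) := by
  have := integral_mul_annihilation hq hp (by linarith) hfd hGd hf hG j
  rw [← integral_comp_star_bargmannMeasure, ← integral_comp_star_bargmannMeasure
    (fun u => annihilation j G u * f (star u))]
  simp only [star_star, creation]
  calc _ = ∫ u, u j * f u * G (star u) ∂(bargmannMeasure n) := by
        congr 1; ext u; ring
    _ = ∫ u, f u * annihilation j G (star u) ∂(bargmannMeasure n) := this.symm
    _ = _ := by congr 1; ext u; ring

end Bargmann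

/-! ### Unitary operators from Gram matrices -/

section Gram

variable {ι H : Type*} [NormedAddCommGroup H] [InnerProductSpace ℂ H] [CompleteSpace H]

/-- Let `e` be a total family, and let `t`, `t'` be families with the Gram matrix of `e` whose
mixed Gram matrices with `e` are adjoint to each other. Then a unitary operator maps `e` to `t`. -/
theorem exists_linearIsometryEquiv_of_inner_eq {e t t' : ι → H}
    (he : ∀ x : H, (∀ i, inner ℂ (e i) x = 0) → x = 0)
    (ht : ∀ i j, inner ℂ (t i) (t j) = inner ℂ (e i) (e j))
    (ht' : ∀ i j, inner ℂ (t' i) (t' j) = inner ℂ (e i) (e j))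
    (htt' : ∀ i j, inner ℂ (t i) (e j) = inner ℂ (e i) (t' j)) :
    ∃ U : H ≃ₗᵢ[ℂ] H, ∀ i, U (e i) = t i := by
  have hext : ∀ x y : H, (∀ i, inner ℂ (e i) x = inner ℂ (e i) y) → x = y := fun x y h =>
    sub_eq_zero.1 (he _ fun i => by rw [inner_sub_right, h, sub_self])
  have hspan : (Submodule.span ℂ (Set.range e)).topologicalClosure = ⊤ := by
    rw [Submodule.topologicalClosure_eq_top_iff, Submodule.eq_bot_iff]
    intro x hx
    exact he x fun i => (Submodule.mem_orthogonal _ _).1 hx _ (Submodule.subset_span ⟨i, rfl⟩)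
  have hdense : DenseRange (Finsupp.linearCombination ℂ e) := by
    rw [DenseRange, ← LinearMap.coe_range, Finsupp.range_linearCombination]
    exact Submodule.dense_iff_topologicalClosure_eq_top.2 hspan
  have hnorm : ∀ x, ‖Finsupp.linearCombination ℂ t x‖ ≤ 1 * ‖Finsupp.linearCombination ℂ e x‖ := by
    intro x
    have : inner ℂ (Finsupp.linearCombination ℂ t x) (Finsupp.linearCombination ℂ t x) =
        inner ℂ (Finsupp.linearCombination ℂ e x) (Finsupp.linearCombination ℂ e x) := by
      simp only [Finsupp.linearCombination_apply, Finsupp.sum, sum_inner, inner_sum,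
        inner_smul_left, inner_smul_right, ht]
    rw [one_mul, ← sq_le_sq₀ (norm_nonneg _) (norm_nonneg _), norm_sq_eq_re_inner (𝕜 := ℂ),
      norm_sq_eq_re_inner (𝕜 := ℂ), this]
  set T : H →L[ℂ] H :=
    (Finsupp.linearCombination ℂ t).extendOfNorm (Finsupp.linearCombination ℂ e)
  have hT : ∀ i, T (e i) = t i := fun i => by
    simpa using LinearMap.extendOfNorm_eq hdense ⟨1, hnorm⟩ (Finsupp.single i 1)
  -- The mixed Gram condition identifies the adjoint on the total family. The Gram matrix of `t`
  -- then gives `T* T = 1` and that of `t'` gives `T T* = 1`.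
  have hT' : ∀ i, T.adjoint (e i) = t' i := fun i => hext _ _ fun j => by
    rw [ContinuousLinearMap.adjoint_inner_right, hT, htt']
  have hdense' : Dense (Submodule.span ℂ (Set.range e) : Set H) :=
    Submodule.dense_iff_topologicalClosure_eq_top.2 hspan
  have h1 : T.adjoint ∘L T = ContinuousLinearMap.id ℂ H := by
    refine ContinuousLinearMap.ext_on hdense' ?_
    rintro _ ⟨i, rfl⟩
    refine hext _ _ fun j => ?_
    simp [ContinuousLinearMap.adjoint_inner_right, hT, ht]
  have h2 : T ∘L T.adjoint = ContinuousLinearMap.id ℂ H := by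
    refine ContinuousLinearMap.ext_on hdense' ?_
    rintro _ ⟨i, rfl⟩
    refine hext _ _ fun j => ?_
    rw [ContinuousLinearMap.comp_apply, ← ContinuousLinearMap.adjoint_inner_left, hT', hT', ht']
    rfl
  have h1' : ∀ x, T.adjoint (T x) = x := fun x => DFunLike.congr_fun h1 x
  have h2' : ∀ x, T (T.adjoint x) = x := fun x => DFunLike.congr_fun h2 x
  refine ⟨⟨⟨T, T.adjoint, h1', h2'⟩, fun x => ?_⟩, fun i => hT i⟩
  change ‖T x‖ = ‖x‖
  rw [← sq_eq_sq₀ (norm_nonneg _) (norm_nonneg _), norm_sq_eq_re_inner (𝕜 := ℂ),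
    norm_sq_eq_re_inner (𝕜 := ℂ) x, ← ContinuousLinearMap.adjoint_inner_right, h1']

end Gram

namespace Bargmann

variable {n : ℕ}

/-! ### Completeness -/

lemma inner_toLp (f g : BargmannSpace n) :
    inner ℂ (f.2.2.toLp (fun u => f (star u))) (g.2.2.toLp (fun u => g (star u))) =
      inner ℂ f g := by
  rw [L2.inner_def, inner_eq]
  refine integral_congr_ae ?_
  filter_upwards [f.2.2.coeFn_toLp, g.2.2.coeFn_toLp] with u hf hg
  simp [hf, hg, mul_comm]

/-- The embedding into the space of square integrable functions. -/
def toL2 (n : ℕ) : BargmannSpace n →ₗᵢ[ℂ] Lp ℂ 2 (bargmannMeasure n) where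
  toFun f := f.2.2.toLp (fun u => f (star u))
  map_add' _ _ := rfl
  map_smul' _ _ := rfl
  norm_map' f := by
    change ‖f.2.2.toLp (fun u => f (star u))‖ = ‖f‖
    rw [← sq_eq_sq₀ (norm_nonneg _) (norm_nonneg _), norm_sq_eq_re_inner (𝕜 := ℂ),
      norm_sq_eq_re_inner (𝕜 := ℂ) f, inner_toLp]

lemma coeFn_toL2 (f : BargmannSpace n) :
    toL2 n f =ᵐ[bargmannMeasure n] fun u => f (star u) := f.2.2.coeFn_toLp

lemma inner_toL2_coherent (z : Fin n → ℂ) (F : Lp ℂ 2 (bargmannMeasure n)) :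
    inner ℂ (toL2 n (coherent (star z))) F =
      ∫ u, F u * Complex.exp (u ⬝ᵥ z) ∂(bargmannMeasure n) := by
  rw [L2.inner_def]
  refine integral_congr_ae ?_
  filter_upwards [coeFn_toL2 (coherent (star z))] with u hu
  have := star_coherent (star z) u
  rw [star_star] at this
  rw [RCLike.inner_apply, hu, ← this]
  rfl

/-- Pairing with coherent vectors is continuous on `L²`, so `L²` convergence to `F` forces pointwise
convergence to the Laplace transform `g` of `F`, which is entire. An almost everywhere convergent
subsequence identifies `F` with `u ↦ g(ū)`. -/
instance : CompleteSpace (BargmannSpace n) := by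
  refine Metric.complete_of_cauchySeq_tendsto fun f hf => ?_
  obtain ⟨F, hF⟩ := cauchySeq_tendsto_of_complete 
    ((toL2 n).isometry.uniformContinuous.comp_cauchySeq hf)
  set g : (Fin n → ℂ) → ℂ := fun z => ∫ u, F u * Complex.exp (u ⬝ᵥ z) ∂(bargmannMeasure n) with hg
  have hlim : ∀ z, Filter.Tendsto (fun k => f k z) Filter.atTop (nhds (g z)) := by
    intro z
    have h1 := (continuous_const (y := toL2 n (coherent (star z)))).inner (𝕜 := ℂ) continuous_id
      |>.tendsto F |>.comp hF
    simp only [id, inner_toL2_coherent] at h1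
    refine h1.congr fun k => ?_
    simp only [Function.comp_apply]
    rw [← inner_toL2_coherent, (toL2 n).inner_map_map, inner_coherent, star_star]
  have hae : F =ᵐ[bargmannMeasure n] fun u => g (star u) := by
    obtain ⟨ns, hns, h⟩ := (tendstoInMeasure_of_tendsto_Lp hF).exists_seq_tendsto_ae
    have h2 : ∀ᵐ u ∂(bargmannMeasure n), ∀ k, toL2 n (f k) u = f k (star u) :=
      ae_all_iff.2 fun k => coeFn_toL2 (f k)
    filter_upwards [h, h2] with u h h2
    refine tendsto_nhds_unique h ?_
    refine ((hlim (star u)).comp hns.tendsto_atTop).congr fun k => ?_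
    exact (h2 (ns k)).symm
  have hgd : Differentiable ℂ g := (MemLp.expIntegrable (Lp.memLp F)).differentiable
  have hmem : g ∈ bargmannSubmodule n := ⟨hgd, (memLp_congr_ae hae).1 (Lp.memLp F)⟩
  refine ⟨ofMem g hmem, ?_⟩
  rw [(toL2 n).isometry.isEmbedding.tendsto_nhds_iff]
  convert hF
  refine Lp.ext ((coeFn_toL2 _).trans hae.symm)

lemma eq_zero_of_inner_coherent (f : BargmannSpace n)
    (h : ∀ p, inner ℂ (coherent p) f = 0) : f = 0 :=
  coe_ext fun z => by
    have := h (star z)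
    rwa [inner_coherent, star_star] at this

/-! ### The norm of a Gaussian -/

/-- The unnormalized integral of `|exp (½ u S u)|²` against the Gaussian measure. -/
def gaussLIntegral (S : Matrix (Fin n) (Fin n) ℂ) : ENNReal :=
  ∫⁻ u : Fin n → ℂ, ENNReal.ofReal (Real.exp (-sqNorm u + (u ⬝ᵥ S *ᵥ u).re))

/-- The substitution `u ↦ i u` preserves `|u|²` and changes the sign of the quadratic form. -/
lemma gaussLIntegral_neg (S : Matrix (Fin n) (Fin n) ℂ) :
    gaussLIntegral (-S) = gaussLIntegral S := by
  unfold gaussLIntegral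
  rw [← (measurePreserving_smul (n := n) (c := Complex.I) (by simp)).lintegral_comp_emb
    (measurableEmbedding_smul (by simp))]
  refine lintegral_congr fun u => ?_
  congr 4
  · simp [sqNorm]
  · simp only [neg_mulVec, dotProduct_neg, mulVec_smul, dotProduct_smul, smul_dotProduct,
      smul_eq_mul]
    linear_combination -(u ⬝ᵥ S *ᵥ u) * Complex.I_sq

lemma dotProduct_mulVec_comm {S : Matrix (Fin n) (Fin n) ℂ} (hS : S.IsSymm) (u v : Fin n → ℂ) :
    u ⬝ᵥ S *ᵥ v = v ⬝ᵥ S *ᵥ u := by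
  rw [dotProduct_comm, ← vecMul_transpose, hS.eq, ← dotProduct_mulVec]

lemma continuous_dotProduct_mulVec (S : Matrix (Fin n) (Fin n) ℂ) :
    Continuous fun p : (Fin n → ℂ) × (Fin n → ℂ) => p.1 ⬝ᵥ S *ᵥ p.2 := by
  unfold dotProduct mulVec dotProduct
  fun_prop

lemma lintegral_comp_mulVec {P : Matrix (Fin n) (Fin n) ℂ} (hP : P.det ≠ 0)
    {h : (Fin n → ℂ) → ENNReal} (hh : Measurable h) :
    ∫⁻ u, h (P *ᵥ u) = ENNReal.ofReal (‖P.det‖⁻¹ ^ 2) * ∫⁻ u, h u := by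
  -- As a real linear map, a complex matrix has determinant `|det P|²`.
  have hdet : LinearMap.det ((toLin' P).restrictScalars ℝ) = ‖P.det‖ ^ 2 := by
    rw [LinearMap.det_restrictScalars, LinearMap.det_toLin', Algebra.norm_complex_apply,
      Complex.normSq_eq_norm_sq]
  have h0 : LinearMap.det ((toLin' P).restrictScalars ℝ) ≠ 0 := by
    rw [hdet]; positivity
  have := Measure.map_linearMap_addHaar_eq_smul_addHaar (volume : Measure (Fin n → ℂ)) h0
  rw [hdet] at this
  have h1 := lintegral_map (μ := volume) hh
    ((toLin' P).restrictScalars ℝ).continuous_of_finiteDimensional.measurable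
  rw [this, lintegral_smul_measure, smul_eq_mul] at h1
  rw [abs_of_nonneg (by positivity), ← inv_pow] at h1
  exact h1.symm

/-- In the double integral with opposite signs, the sum and half the difference of the variables
turn the quadratic forms into a single cross term `-2 Re (s·Su)`, which is linear in `s`. Completing
the square in `s` replaces it by `2|Su|²`. The integrand is nonnegative, so no integrability is
needed for the exchanges. -/
lemma gaussLIntegral_mul_neg {S : Matrix (Fin n) (Fin n) ℂ} (hS : S.IsSymm) :
    gaussLIntegral S * gaussLIntegral (-S) =
      (∫⁻ s : Fin n → ℂ, ENNReal.ofReal (Real.exp (-(1 / 2 * sqNorm s)))) *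
      ∫⁻ u : Fin n → ℂ, ENNReal.ofReal (Real.exp (-(2 * (sqNorm u - sqNorm (S *ᵥ u))))) := by
  have hc := continuous_dotProduct_mulVec S
  have hc1 : ∀ {X : Type} [TopologicalSpace X] {f g : X → Fin n → ℂ}, Continuous f →
      Continuous g → Continuous fun x => f x ⬝ᵥ S *ᵥ g x := fun hf hg => hc.comp (hf.prodMk hg)
  have hSd : ∀ u v : Fin n → ℂ, u ⬝ᵥ S *ᵥ v = v ⬝ᵥ S *ᵥ u := dotProduct_mulVec_comm hS
  calc gaussLIntegral S * gaussLIntegral (-S)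
      = ∫⁻ u : Fin n → ℂ, ∫⁻ w : Fin n → ℂ, ENNReal.ofReal
          (Real.exp (-sqNorm w + (w ⬝ᵥ S *ᵥ w).re - sqNorm u - (u ⬝ᵥ S *ᵥ u).re)) := by
        have m1 : Measurable fun w : Fin n → ℂ =>
            ENNReal.ofReal (Real.exp (-sqNorm w + (w ⬝ᵥ S *ᵥ w).re)) :=
          (ENNReal.continuous_ofReal.comp (Real.continuous_exp.comp (continuous_sqNorm.neg.add
            (Complex.continuous_re.comp (hc1 continuous_id continuous_id))))).measurable
        have m2 : Measurable fun w : Fin n → ℂ =>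
            ENNReal.ofReal (Real.exp (-sqNorm w + (w ⬝ᵥ (-S) *ᵥ w).re)) := by
          have := continuous_dotProduct_mulVec (-S)
          exact (ENNReal.continuous_ofReal.comp (Real.continuous_exp.comp (continuous_sqNorm.neg.add
            (Complex.continuous_re.comp (this.comp
              (continuous_id.prodMk continuous_id)))))).measurable
        rw [gaussLIntegral, gaussLIntegral, ← lintegral_const_mul _ m2]
        refine lintegral_congr fun u => ?_
        rw [← lintegral_mul_const _ m1]
        refine lintegral_congr fun w => ?_
        rw [← ENNReal.ofReal_mul (Real.exp_pos _).le, ← Real.exp_add, neg_mulVec, dotProduct_neg,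
          Complex.neg_re]
        ring_nf
    _ = ∫⁻ u : Fin n → ℂ, ∫⁻ s : Fin n → ℂ, ENNReal.ofReal
          (Real.exp (-sqNorm (s - u) + ((s - u) ⬝ᵥ S *ᵥ (s - u)).re - sqNorm u -
            (u ⬝ᵥ S *ᵥ u).re)) := by
        refine lintegral_congr fun u => ?_
        rw [lintegral_sub_right_eq_self (fun w : Fin n → ℂ => ENNReal.ofReal
          (Real.exp (-sqNorm w + (w ⬝ᵥ S *ᵥ w).re - sqNorm u - (u ⬝ᵥ S *ᵥ u).re))) u]
    _ = ∫⁻ s : Fin n → ℂ, ∫⁻ u : Fin n → ℂ, ENNReal.ofReal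
          (Real.exp (-sqNorm (s - u) + ((s - u) ⬝ᵥ S *ᵥ (s - u)).re - sqNorm u -
            (u ⬝ᵥ S *ᵥ u).re)) := by
        refine lintegral_lintegral_swap (Measurable.aemeasurable ?_)
        have m : Continuous fun p : (Fin n → ℂ) × (Fin n → ℂ) =>
            -sqNorm (p.2 - p.1) + ((p.2 - p.1) ⬝ᵥ S *ᵥ (p.2 - p.1)).re - sqNorm p.1 -
            (p.1 ⬝ᵥ S *ᵥ p.1).re := by
          have c1 := Complex.continuous_re.comp (hc1 (X := (Fin n → ℂ) × (Fin n → ℂ))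
            (continuous_snd.sub continuous_fst) (continuous_snd.sub continuous_fst))
          have c2 := Complex.continuous_re.comp (hc1 (X := (Fin n → ℂ) × (Fin n → ℂ))
            continuous_fst continuous_fst)
          exact (((continuous_sqNorm.comp (continuous_snd.sub continuous_fst)).neg.add c1).sub
            (continuous_sqNorm.comp continuous_fst)).sub c2
        exact (ENNReal.continuous_ofReal.comp (Real.continuous_exp.comp m)).measurable
    _ = ∫⁻ s : Fin n → ℂ, ∫⁻ u : Fin n → ℂ, ENNReal.ofReal
          (Real.exp (-(1 / 2 * sqNorm s) - 2 * sqNorm u - 2 * (s ⬝ᵥ S *ᵥ u).re)) := by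
        refine lintegral_congr fun s => ?_
        -- Centring `u` at `s/2` makes the two points `s/2 - u` and `s/2 + u`, so the terms
        -- quadratic in `s` or in `u` cancel in the difference of the forms.
        rw [← lintegral_add_right_eq_self _ ((2⁻¹ : ℂ) • s)]
        refine lintegral_congr fun u => ?_
        congr 2
        have e1 : sqNorm (s - (u + (2⁻¹ : ℂ) • s)) + sqNorm (u + (2⁻¹ : ℂ) • s) =
            1 / 2 * sqNorm s + 2 * sqNorm u := by
          apply Complex.ofReal_injective
          push_cast
          simp only [ofReal_sqNorm, star_sub, star_add, star_smul, sub_dotProduct, dotProduct_sub,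
            add_dotProduct, dotProduct_add, smul_dotProduct, dotProduct_smul, smul_eq_mul,
            Complex.star_def, map_inv₀, Complex.conj_ofNat]
          ring
        have e2 : (s - (u + (2⁻¹ : ℂ) • s)) ⬝ᵥ S *ᵥ (s - (u + (2⁻¹ : ℂ) • s)) -
            (u + (2⁻¹ : ℂ) • s) ⬝ᵥ S *ᵥ (u + (2⁻¹ : ℂ) • s) = (-2 : ℝ) * (s ⬝ᵥ S *ᵥ u) := by
          push_cast
          simp only [mulVec_sub, mulVec_add, mulVec_smul, sub_dotProduct, dotProduct_sub,
            add_dotProduct, dotProduct_add, smul_dotProduct, dotProduct_smul, smul_eq_mul, hSd u s]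
          ring
        have e3 := congrArg Complex.re e2
        rw [Complex.re_ofReal_mul, Complex.sub_re] at e3
        linarith
    _ = ∫⁻ u : Fin n → ℂ, ∫⁻ s : Fin n → ℂ, ENNReal.ofReal
          (Real.exp (-(1 / 2 * sqNorm s) - 2 * sqNorm u - 2 * (s ⬝ᵥ S *ᵥ u).re)) := by
        refine lintegral_lintegral_swap (Measurable.aemeasurable ?_)
        have m : Continuous fun p : (Fin n → ℂ) × (Fin n → ℂ) =>
            -(1 / 2 * sqNorm p.1) - 2 * sqNorm p.2 - 2 * (p.1 ⬝ᵥ S *ᵥ p.2).re := by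
          fun_prop
        exact (ENNReal.continuous_ofReal.comp (Real.continuous_exp.comp m)).measurable
    _ = ∫⁻ u : Fin n → ℂ, (∫⁻ s : Fin n → ℂ, ENNReal.ofReal (Real.exp (-(1 / 2 * sqNorm s)))) *
          ENNReal.ofReal (Real.exp (-(2 * (sqNorm u - sqNorm (S *ᵥ u))))) := by
        refine lintegral_congr fun u => ?_
        have m : Measurable fun s : Fin n → ℂ =>
            ENNReal.ofReal (Real.exp (-(1 / 2 * sqNorm s))) :=
          (ENNReal.continuous_ofReal.comp (Real.continuous_exp.comp (by fun_prop))).measurable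
        -- The shift by twice the conjugate of `Su` completes the square in `s`.
        rw [← lintegral_sub_right_eq_self _ ((2 : ℂ) • star (S *ᵥ u)), ← lintegral_mul_const _ m]
        refine lintegral_congr fun s => ?_
        rw [← ENNReal.ofReal_mul (Real.exp_pos _).le, ← Real.exp_add]
        congr 2
        set a := S *ᵥ u
        have e1 : (sqNorm (s - (2 : ℂ) • star a) : ℂ) =
            sqNorm s - 2 * (s ⬝ᵥ a) - 2 * (star (s ⬝ᵥ a)) + 4 * sqNorm a := by
          simp only [ofReal_sqNorm, star_sub, star_smul, star_star, sub_dotProduct,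
            dotProduct_sub, smul_dotProduct, dotProduct_smul, smul_eq_mul, Complex.star_def,
            Complex.conj_ofNat, dotProduct_comm a s, dotProduct_comm a (star a)]
          rw [← Complex.star_def, star_dotProduct_star, dotProduct_comm a s]
          ring
        have e2 := congrArg Complex.re e1
        have e3 : ((s - (2 : ℂ) • star a) ⬝ᵥ a) = s ⬝ᵥ a - 2 * sqNorm a := by
          simp [ofReal_sqNorm]
        have e4 : ((s - (2 : ℂ) • star a) ⬝ᵥ a).re = (s ⬝ᵥ a).re - 2 * sqNorm a := by
          rw [e3]; simp
        simp at e2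
        rw [e4, e2]
        ring
    _ = _ := by
        refine lintegral_const_mul _ ?_
        have : Continuous fun u : Fin n → ℂ => S *ᵥ u := by fun_prop
        exact (ENNReal.continuous_ofReal.comp (Real.continuous_exp.comp (by fun_prop))).measurable

/-- The product formula for `S` and the one for `0` differ only in the last integral, where `u ↦ Pu`
is a linear change of variables. -/
lemma gaussLIntegral_sq {S P : Matrix (Fin n) (Fin n) ℂ} (hS : S.IsSymm) (hP : P.det ≠ 0)
    (h : ∀ u, sqNorm u - sqNorm (S *ᵥ u) = sqNorm (P *ᵥ u)) :
    gaussLIntegral S ^ 2 =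
      (ENNReal.ofReal ‖P.det‖⁻¹ * gaussLIntegral (0 : Matrix (Fin n) _ ℂ)) ^ 2 := by
  have h0 := gaussLIntegral_mul_neg (S := (0 : Matrix (Fin n) (Fin n) ℂ)) (by simp [Matrix.IsSymm])
  have h1 := gaussLIntegral_mul_neg hS
  rw [gaussLIntegral_neg, ← sq] at h0 h1
  have hm : Measurable fun u : Fin n → ℂ => ENNReal.ofReal (Real.exp (-(2 * sqNorm u))) :=
    (ENNReal.continuous_ofReal.comp (Real.continuous_exp.comp (by fun_prop))).measurable
  simp only [h] at h1
  rw [lintegral_comp_mulVec hP hm] at h1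
  have hz : sqNorm (0 : Fin n → ℂ) = 0 := by simp [sqNorm]
  simp only [zero_mulVec, hz, sub_zero] at h0
  rw [h1, mul_pow, h0, ← ENNReal.ofReal_pow (by positivity)]
  ring

/-- Only the ratio to the case `S = 0` matters: that case is the total mass `1`, so the reference
integral need not be evaluated here. -/
lemma norm_sq_quadExp {S P : Matrix (Fin n) (Fin n) ℂ} (hS : S.IsSymm) (hP : P.det ≠ 0)
    (h : ∀ u, sqNorm u - sqNorm (S *ᵥ u) = sqNorm (P *ᵥ u))
    (hmem : quadExp S 0 ∈ bargmannSubmodule n) :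
    ‖ofMem _ hmem‖ ^ 2 = ‖P.det‖⁻¹ := by
  -- Squaring is injective on `[0, ∞]`, so finiteness plays no role.
  have h1 : gaussLIntegral S = ENNReal.ofReal ‖P.det‖⁻¹ * gaussLIntegral (0 : Matrix (Fin n) _ ℂ) :=
    (ENNReal.pow_right_strictMono two_ne_zero).injective (gaussLIntegral_sq hS hP h)
  have h2 : ∀ T : Matrix (Fin n) (Fin n) ℂ,
      ∫ u : Fin n → ℂ, weight u * Real.exp ((u ⬝ᵥ T *ᵥ u).re) =
        (Real.pi ^ n)⁻¹ * (gaussLIntegral T).toReal := by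
    intro T
    have hc := continuous_dotProduct_mulVec T
    have hc' : Continuous fun u : Fin n → ℂ => (u ⬝ᵥ T *ᵥ u).re :=
      Complex.continuous_re.comp (hc.comp (continuous_id.prodMk continuous_id))
    simp only [weight_eq, mul_assoc, ← Real.exp_add]
    rw [integral_const_mul, integral_eq_lintegral_of_nonneg_ae
      (Filter.Eventually.of_forall fun u => (Real.exp_pos _).le)
      (Continuous.aestronglyMeasurable (by fun_prop))]
    rfl
  have h3 := h2 0
  simp only [zero_mulVec, dotProduct_zero, Complex.zero_re, Real.exp_zero, mul_one,
    integral_weight] at h3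
  have h4 : inner ℂ (ofMem _ hmem) (ofMem _ hmem) =
      ((∫ u : Fin n → ℂ, weight u * Real.exp ((u ⬝ᵥ S *ᵥ u).re) : ℝ) : ℂ) := by
    rw [inner_eq, integral_comp_star_bargmannMeasure (fun u => star (ofMem _ hmem u) *
      ofMem _ hmem u), integral_bargmannMeasure, ← integral_complex_ofReal]
    refine integral_congr_ae (Filter.Eventually.of_forall fun u => ?_)
    simp only [ofMem_apply]
    rw [Complex.star_def, Complex.conj_mul', quadExp, Complex.norm_exp, ← Complex.ofReal_pow,
      ← Complex.ofReal_mul, ← Real.exp_nat_mul]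
    congr 3
    simp
  rw [norm_sq_eq_re_inner (𝕜 := ℂ), h4, h2, h1, ENNReal.toReal_mul,
    ENNReal.toReal_ofReal (by positivity), mul_left_comm, ← h3, mul_one]
  exact Complex.ofReal_re _

/-! ### Bogoliubov matrices -/

/-- The conditions on the coefficients of a Bogoliubov transformation. -/
structure IsBogoliubov (Φ Ψ : Matrix (Fin n) (Fin n) ℂ) : Prop where
  symm : Φ * Ψᵀ = Ψ * Φᵀ
  unit : Φ * Φᴴ - Ψ * Ψᴴ = 1

/-- The block of the kernel that is quadratic in the integration variable. -/
def kerIn (Φ Ψ : Matrix (Fin n) (Fin n) ℂ) : Matrix (Fin n) (Fin n) ℂ := Ψ.map star * Φ⁻¹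

/-- The block of the kernel that is quadratic in the free variable. -/
def kerOut (Φ Ψ : Matrix (Fin n) (Fin n) ℂ) : Matrix (Fin n) (Fin n) ℂ := -(Φ⁻¹ * Ψ)

/-- Passing to the coefficients `Φᴴ`, `-Ψᵀ` of the inverse exchanges the two diagonal blocks up to
adjoints; facts about one block transfer to the other. -/
lemma kerIn_inv (Φ Ψ : Matrix (Fin n) (Fin n) ℂ) : kerIn Φᴴ (-Ψᵀ) = (kerOut Φ Ψ)ᴴ := by
  have : (-Ψᵀ).map star = -Ψᴴ := by ext; simp
  rw [kerIn, kerOut, this, conjTranspose_neg, conjTranspose_mul, conjTranspose_nonsing_inv,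
    Matrix.neg_mul]

lemma kerOut_inv (Φ Ψ : Matrix (Fin n) (Fin n) ℂ) : kerOut Φᴴ (-Ψᵀ) = (kerIn Φ Ψ)ᴴ := by
  have : (Ψ.map star)ᴴ = Ψᵀ := by ext; simp
  rw [kerIn, kerOut, conjTranspose_mul, this, conjTranspose_nonsing_inv, Matrix.mul_neg, neg_neg]

lemma map_star_eq (Φ : Matrix (Fin n) (Fin n) ℂ) : Φ.map star = Φᵀᴴ := by ext; simp

namespace IsBogoliubov

variable {Φ Ψ : Matrix (Fin n) (Fin n) ℂ}

lemma conj_symm (h : IsBogoliubov Φ Ψ) : Φᵀᴴ * Ψᴴ = Ψᵀᴴ * Φᴴ := by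
  have := congrArg (fun M => Mᵀᴴ) h.symm
  simpa [transpose_mul, conjTranspose_mul] using this

lemma conj_unit (h : IsBogoliubov Φ Ψ) : Φᵀᴴ * Φᵀ - Ψᵀᴴ * Ψᵀ = 1 := by
  have e : ∀ M : Matrix (Fin n) (Fin n) ℂ, Mᴴᵀ = Mᵀᴴ := fun M => by ext; simp
  have := congrArg (fun M => Mᵀ) h.unit
  simpa only [transpose_sub, transpose_mul, e, transpose_one] using this

-- `ΦΦ* = 1 + ΨΨ*` is positive definite.
open scoped ComplexOrder in
lemma isUnit (h : IsBogoliubov Φ Ψ) : IsUnit Φ := by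
  have h1 : (Φ * Φᴴ).PosDef := by
    rw [sub_eq_iff_eq_add.1 h.unit]
    exact PosDef.one.add_posSemidef (posSemidef_self_mul_conjTranspose Ψ)
  have h2 := (isUnit_iff_isUnit_det _).1 h1.isUnit
  rw [det_mul] at h2
  exact (isUnit_iff_isUnit_det _).2 (isUnit_of_mul_isUnit_left h2)

lemma isUnit_det (h : IsBogoliubov Φ Ψ) : IsUnit Φ.det := (isUnit_iff_isUnit_det _).1 h.isUnit

/-- The conditions and their conjugates say that the product in the opposite order is `1`. For
square matrices this suffices, and the order stated here yields the conditions for the inverse. -/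
lemma blocks_mul (h : IsBogoliubov Φ Ψ) :
    fromBlocks Φᴴ (-Ψᵀ) (-Ψᴴ) Φᵀ * fromBlocks Φ Ψ Ψᵀᴴ Φᵀᴴ = 1 := by
  rw [mul_eq_one_comm, fromBlocks_multiply, ← fromBlocks_one]
  have h1 := h.symm
  have h2 := h.unit
  have h3 := h.conj_symm
  have h4 := h.conj_unit
  congr 1
  · rw [← h2]; simp [sub_eq_add_neg]
  · rw [Matrix.mul_neg, h1]; simp
  · rw [Matrix.mul_neg, h3]; simp
  · rw [← h4]; simp [sub_eq_add_neg, add_comm]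

/-- The coefficients of the inverse transformation. -/
lemma inv (h : IsBogoliubov Φ Ψ) : IsBogoliubov Φᴴ (-Ψᵀ) := by
  have := h.blocks_mul
  rw [fromBlocks_multiply, ← fromBlocks_one, fromBlocks_inj] at this
  obtain ⟨h1, h2, -, -⟩ := this
  have e : Φᴴᵀ = Φᵀᴴ := by ext; simp
  constructor
  · rw [e, transpose_neg, transpose_transpose]
    rw [Matrix.mul_neg]
    exact (eq_neg_of_add_eq_zero_right h2) ▸ by simp
  · rw [conjTranspose_conjTranspose, ← h1, conjTranspose_neg]
    simp [sub_eq_add_neg]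

lemma kerOut_isSymm (h : IsBogoliubov Φ Ψ) : (kerOut Φ Ψ).IsSymm := by
  have hu := h.isUnit_det
  have hu' : IsUnit Φᵀ.det := by rwa [det_transpose]
  rw [kerOut, Matrix.IsSymm, transpose_neg, transpose_mul, transpose_nonsing_inv, neg_inj]
  calc Ψᵀ * Φᵀ⁻¹ = Φ⁻¹ * (Φ * Ψᵀ) * Φᵀ⁻¹ := by rw [nonsing_inv_mul_cancel_left _ _ hu]
    _ = Φ⁻¹ * Ψ := by
      rw [h.symm, Matrix.mul_assoc, Matrix.mul_assoc, mul_nonsing_inv _ hu', Matrix.mul_one]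

lemma kerIn_isSymm (h : IsBogoliubov Φ Ψ) : (kerIn Φ Ψ).IsSymm := by
  have h1 := h.inv.kerOut_isSymm
  rw [kerOut_inv, Matrix.IsSymm] at h1
  have h2 := congrArg conjTranspose h1
  rw [conjTranspose_conjTranspose] at h2
  have e : (kerIn Φ Ψ)ᴴᵀᴴ = (kerIn Φ Ψ)ᵀ := by ext; simp
  rwa [e] at h2

/-- The defect of `kerOut` from being an isometry is carried by the invertible matrix `Φ⁻ᵀ`. This
gives both the strict contraction bound and the determinant in the norm of the Gaussian. -/
lemma kerOut_conjTranspose_mul (h : IsBogoliubov Φ Ψ) :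
    (kerOut Φ Ψ)ᴴ * kerOut Φ Ψ = 1 - (Φ⁻¹)ᵀᴴ * (Φ⁻¹)ᵀ := by
  have hu := h.isUnit_det
  have e1 : kerOut Φ Ψ = -(Ψᵀ * (Φ⁻¹)ᵀ) := by
    rw [← h.kerOut_isSymm.eq, kerOut, transpose_neg, transpose_mul]
  have e2 : Φᵀ * (Φ⁻¹)ᵀ = 1 := by rw [← transpose_mul, nonsing_inv_mul _ hu, transpose_one]
  have e3 : (Φ⁻¹)ᵀᴴ * Φᵀᴴ = 1 := by rw [← conjTranspose_mul, e2, conjTranspose_one]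
  have e4 : Ψᵀᴴ * Ψᵀ = Φᵀᴴ * Φᵀ - 1 := by rw [← h.conj_unit]; abel
  rw [e1, conjTranspose_neg, conjTranspose_mul, neg_mul_neg]
  calc (Φ⁻¹)ᵀᴴ * Ψᵀᴴ * (Ψᵀ * (Φ⁻¹)ᵀ) = (Φ⁻¹)ᵀᴴ * (Ψᵀᴴ * Ψᵀ) * (Φ⁻¹)ᵀ := by
        simp only [Matrix.mul_assoc]
    _ = ((Φ⁻¹)ᵀᴴ * Φᵀᴴ) * (Φᵀ * (Φ⁻¹)ᵀ) - (Φ⁻¹)ᵀᴴ * (Φ⁻¹)ᵀ := by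
        rw [e4, Matrix.mul_sub, Matrix.sub_mul]; simp only [Matrix.mul_assoc, Matrix.mul_one]
    _ = _ := by rw [e2, e3, Matrix.mul_one]

lemma sqNorm_mulVec (M : Matrix (Fin n) (Fin n) ℂ) (u : Fin n → ℂ) :
    (sqNorm (M *ᵥ u) : ℂ) = star u ⬝ᵥ (Mᴴ * M) *ᵥ u := by
  rw [ofReal_sqNorm, star_mulVec, ← dotProduct_mulVec, mulVec_mulVec]

lemma sqNorm_sub_sqNorm (h : IsBogoliubov Φ Ψ) (u : Fin n → ℂ) :
    sqNorm u - sqNorm (kerOut Φ Ψ *ᵥ u) = sqNorm ((Φ⁻¹)ᵀ *ᵥ u) := by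
  apply Complex.ofReal_injective
  rw [Complex.ofReal_sub, sqNorm_mulVec, sqNorm_mulVec, h.kerOut_conjTranspose_mul,
    sub_mulVec, one_mulVec, dotProduct_sub, ofReal_sqNorm]
  ring

end IsBogoliubov

/-! ### Contraction bounds for the diagonal blocks -/

lemma norm_dotProduct_sq_le (u v : Fin n → ℂ) : ‖u ⬝ᵥ v‖ ^ 2 ≤ sqNorm u * sqNorm v := by
  have h1 : ‖u ⬝ᵥ v‖ ≤ ∑ j, ‖u j‖ * ‖v j‖ :=
    (norm_sum_le _ _).trans (Finset.sum_le_sum fun j _ => by rw [norm_mul])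
  calc _ ≤ (∑ j, ‖u j‖ * ‖v j‖) ^ 2 := by gcongr
    _ ≤ _ := Finset.sum_mul_sq_le_sq_mul_sq _ _ _

lemma sqNorm_mulVec_le (M : Matrix (Fin n) (Fin n) ℂ) (u : Fin n → ℂ) :
    sqNorm (M *ᵥ u) ≤ (∑ i, sqNorm (M i)) * sqNorm u := by
  rw [Finset.sum_mul, sqNorm]
  exact Finset.sum_le_sum fun i _ => norm_dotProduct_sq_le _ _

/-- Since `Φᵀ` inverts `Φ⁻ᵀ`, `|z|² ≤ C |Φ⁻ᵀz|²`, hence `|Sz|² ≤ (1 - 1/C)|z|²` for `S = kerOut Φ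
Ψ`. The summand `1` in `C` ensures `C ≥ 1`. -/
lemma IsBogoliubov.exists_norm_le {Φ Ψ : Matrix (Fin n) (Fin n) ℂ} (h : IsBogoliubov Φ Ψ) :
    ∃ r : ℝ, 0 ≤ r ∧ r < 1 ∧ ∀ z : Fin n → ℂ, ‖z ⬝ᵥ kerOut Φ Ψ *ᵥ z‖ ≤ r * sqNorm z := by
  set C : ℝ := 1 + ∑ i, sqNorm (Φᵀ i) with hC
  have hC1 : 1 ≤ C := by
    rw [hC]; linarith [Finset.sum_nonneg fun i (_ : i ∈ Finset.univ) => sqNorm_nonneg (Φᵀ i)]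
  have hCpos : 0 < C := by linarith
  have hC2 : 0 ≤ 1 - C⁻¹ := sub_nonneg.2 (inv_le_one_of_one_le₀ hC1)
  refine ⟨√(1 - C⁻¹), Real.sqrt_nonneg _, ?_, fun z => ?_⟩
  · rw [Real.sqrt_lt' one_pos]
    have : 0 < C⁻¹ := by positivity
    linarith
  · have h1 : sqNorm z ≤ C * sqNorm ((Φ⁻¹)ᵀ *ᵥ z) := by
      have e : z = Φᵀ *ᵥ ((Φ⁻¹)ᵀ *ᵥ z) := by
        rw [mulVec_mulVec, ← transpose_mul, nonsing_inv_mul _ h.isUnit_det, transpose_one,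
          one_mulVec]
      calc sqNorm z = sqNorm (Φᵀ *ᵥ ((Φ⁻¹)ᵀ *ᵥ z)) := by rw [← e]
        _ ≤ _ := sqNorm_mulVec_le _ _
        _ ≤ _ := by
          have := sqNorm_nonneg ((Φ⁻¹)ᵀ *ᵥ z)
          gcongr
          linarith
    have h2 := h.sqNorm_sub_sqNorm z
    have h3 : sqNorm (kerOut Φ Ψ *ᵥ z) ≤ (1 - C⁻¹) * sqNorm z := by
      have : C⁻¹ * sqNorm z ≤ sqNorm ((Φ⁻¹)ᵀ *ᵥ z) := by
        rw [inv_mul_le_iff₀ hCpos]; exact h1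
      linarith
    have h4 := sqNorm_nonneg z
    rw [← sq_le_sq₀ (norm_nonneg _) (by positivity), mul_pow, Real.sq_sqrt hC2]
    calc _ ≤ _ := norm_dotProduct_sq_le _ _
      _ ≤ sqNorm z * ((1 - C⁻¹) * sqNorm z) := by gcongr
      _ = _ := by ring

lemma IsBogoliubov.exists_norm_kerIn_le {Φ Ψ : Matrix (Fin n) (Fin n) ℂ}
    (h : IsBogoliubov Φ Ψ) :
    ∃ r : ℝ, 0 ≤ r ∧ r < 1 ∧ ∀ z : Fin n → ℂ, ‖z ⬝ᵥ kerIn Φ Ψ *ᵥ z‖ ≤ r * sqNorm z := by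
  obtain ⟨r, hr0, hr1, hr⟩ := h.inv.exists_norm_le
  refine ⟨r, hr0, hr1, fun z => ?_⟩
  have h1 := hr (star z)
  rw [kerOut_inv, sqNorm_star] at h1
  have h2 : star z ⬝ᵥ (kerIn Φ Ψ)ᴴ *ᵥ star z = star (z ⬝ᵥ kerIn Φ Ψ *ᵥ z) := by
    rw [← star_vecMul, star_dotProduct_star, ← dotProduct_mulVec]
  rwa [h2, norm_star] at h1

/-- A common bound for the Gaussians occurring in the kernel. -/
lemma IsBogoliubov.exists_gaussianBound {Φ Ψ : Matrix (Fin n) (Fin n) ℂ}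
    (h : IsBogoliubov Φ Ψ) : ∃ q : ℝ, 0 < q ∧ q < 1 / 2 ∧
      (∀ ℓ, GaussianBound q (quadExp (kerOut Φ Ψ) ℓ)) ∧
      ∀ ℓ, GaussianBound q (quadExp (kerIn Φ Ψ) ℓ) := by
  obtain ⟨r, hr0, hr1, hr⟩ := h.exists_norm_le
  obtain ⟨s, hs0, hs1, hs⟩ := h.exists_norm_kerIn_le
  -- The midpoint of `max r s / 2` and `1/2`.
  refine ⟨(max r s + 1) / 4, by positivity, ?_, fun ℓ => gaussianBound_quadExp hr ?_ ℓ,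
    fun ℓ => gaussianBound_quadExp hs ?_ ℓ⟩
  · have := max_lt hr1 hs1
    linarith
  · have := le_max_left r s
    linarith
  · have := le_max_right r s
    linarith

/-! ### The kernel -/

/-- The kernel without its constant. -/
def expKernel (Φ Ψ : Matrix (Fin n) (Fin n) ℂ) (w v : Fin n → ℂ) : ℂ :=
  Complex.exp (1 / 2 * (v ⬝ᵥ kerIn Φ Ψ *ᵥ v) + w ⬝ᵥ Φ⁻¹ *ᵥ v + 1 / 2 * (w ⬝ᵥ kerOut Φ Ψ *ᵥ w))

lemma dotProduct_transpose_mulVec (M : Matrix (Fin n) (Fin n) ℂ) (v w : Fin n → ℂ) :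
    v ⬝ᵥ Mᵀ *ᵥ w = w ⬝ᵥ M *ᵥ v := by
  rw [mulVec_transpose, dotProduct_comm, ← dotProduct_mulVec]

lemma bogoliubovKernel_eq (Φ Ψ : Matrix (Fin n) (Fin n) ℂ) (θ : ℂ) (w v : Fin n → ℂ) :
    bogoliubovKernel Φ Ψ θ w v = θ * (Φ * Φᴴ).det ^ (-(1 / 4) : ℂ) * expKernel Φ Ψ w v := by
  rw [bogoliubovKernel, expKernel]
  congr 2
  rw [bogoliubovMatrix, fromBlocks_mulVec, sumElim_dotProduct_sumElim, dotProduct_add,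
    dotProduct_add]
  simp only [Sum.elim_comp_inl, Sum.elim_comp_inr, dotProduct_transpose_mulVec, kerIn, kerOut]
  ring

lemma expKernel_eq_out (Φ Ψ : Matrix (Fin n) (Fin n) ℂ) (w v : Fin n → ℂ) :
    expKernel Φ Ψ w v = quadExp (kerIn Φ Ψ) 0 v * quadExp (kerOut Φ Ψ) (Φ⁻¹ *ᵥ v) w := by
  rw [expKernel, quadExp, quadExp, ← Complex.exp_add, dotProduct_zero]
  congr 1; ring

lemma expKernel_eq_in (Φ Ψ : Matrix (Fin n) (Fin n) ℂ) (w v : Fin n → ℂ) :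
    expKernel Φ Ψ w v = quadExp (kerOut Φ Ψ) 0 w * quadExp (kerIn Φ Ψ) ((Φ⁻¹)ᵀ *ᵥ w) v := by
  rw [expKernel, quadExp, quadExp, ← Complex.exp_add, dotProduct_zero, dotProduct_transpose_mulVec]
  congr 1; ring

lemma star_dotProduct_mulVec_star (M : Matrix (Fin n) (Fin n) ℂ) (x y : Fin n → ℂ) :
    star (star x ⬝ᵥ M *ᵥ star y) = y ⬝ᵥ Mᴴ *ᵥ x := by
  rw [star_dotProduct, star_star, star_mulVec, star_star, ← dotProduct_mulVec]

/-- The kernel of the inverse transformation is the adjoint kernel, which makes inner products with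
kernel vectors into kernel transforms. -/
lemma expKernel_inv (Φ Ψ : Matrix (Fin n) (Fin n) ℂ) (w v : Fin n → ℂ) :
    expKernel Φᴴ (-Ψᵀ) w v = star (expKernel Φ Ψ (star v) (star w)) := by
  rw [expKernel, expKernel, kerIn_inv, kerOut_inv, ← conjTranspose_nonsing_inv,
    ← star_dotProduct_mulVec_star, ← star_dotProduct_mulVec_star, ← star_dotProduct_mulVec_star,
    Complex.star_def, ← Complex.exp_conj]
  congr 1
  simp only [map_add, map_mul, map_div₀, map_one, Complex.conj_ofNat]
  ring

/-- The integral operator with kernel `expKernel`. -/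
def kernelTransform (Φ Ψ : Matrix (Fin n) (Fin n) ℂ) (f : (Fin n → ℂ) → ℂ) (w : Fin n → ℂ) : ℂ :=
  ∫ v, expKernel Φ Ψ w v * f (star v) ∂(bargmannMeasure n)

lemma bogoliubovAnnihilation_apply (Φ Ψ : Matrix (Fin n) (Fin n) ℂ) (j : Fin n)
    (f : (Fin n → ℂ) → ℂ) (z : Fin n → ℂ) :
    bogoliubovAnnihilation Φ Ψ j f z =
      (Φ *ᵥ (fun k => annihilation k f z) + Ψ *ᵥ (fun k => creation k f z)) j := by
  simp [bogoliubovAnnihilation, mulVec, dotProduct, Finset.sum_add_distrib]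

lemma bogoliubovCreation_apply (Φ Ψ : Matrix (Fin n) (Fin n) ℂ) (j : Fin n)
    (f : (Fin n → ℂ) → ℂ) (z : Fin n → ℂ) :
    bogoliubovCreation Φ Ψ j f z =
      (Φ.map star *ᵥ (fun k => creation k f z) +
        Ψ.map star *ᵥ (fun k => annihilation k f z)) j := by
  simp [bogoliubovCreation, mulVec, dotProduct, Finset.sum_add_distrib]

lemma creation_vec (f : (Fin n → ℂ) → ℂ) (z : Fin n → ℂ) :
    (fun k => creation k f z) = f z • z := by
  ext k; simp [creation, mul_comm]

lemma annihilation_comp_mulVec {L : (Fin n → ℂ) → ℂ} (hL : Differentiable ℂ L)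
    (Q : Matrix (Fin n) (Fin n) ℂ) (j : Fin n) (w : Fin n → ℂ) :
    annihilation j (fun w => L (Q *ᵥ w)) w = (Qᵀ *ᵥ fun k => annihilation k L (Q *ᵥ w)) j := by
  have h1 : HasFDerivAt (fun w => Q *ᵥ w) (Q.mulVecLin.toContinuousLinearMap) w :=
    (Q.mulVecLin.toContinuousLinearMap).hasFDerivAt
  have h2 := (hL (Q *ᵥ w)).hasFDerivAt.comp w h1
  have h3 : (Q *ᵥ Pi.single j 1 : Fin n → ℂ) = ∑ k, Q k j • Pi.single k (1 : ℂ) := by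
    ext i
    simp [Pi.single_apply]
  have h4 : annihilation j (fun w => L (Q *ᵥ w)) w =
      fderiv ℂ L (Q *ᵥ w) (Q *ᵥ Pi.single j 1) := by
    exact congrArg (fun T : (Fin n → ℂ) →L[ℂ] ℂ => T (Pi.single j 1)) h2.fderiv
  rw [h4, h3, map_sum]
  simp [mulVec, dotProduct, annihilation]

/-! ### Intertwining relations of the kernel -/

namespace IsBogoliubov

variable {Φ Ψ : Matrix (Fin n) (Fin n) ℂ} {f : (Fin n → ℂ) → ℂ}

lemma matrixA_isSymm (h : IsBogoliubov Φ Ψ) : (bogoliubovMatrix Φ Ψ).IsSymm := by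
  rw [bogoliubovMatrix, Matrix.IsSymm, fromBlocks_transpose, transpose_transpose]
  congr 1
  · exact h.kerIn_isSymm.eq
  · exact h.kerOut_isSymm.eq

lemma gaussianBound_expKernel_out (h : IsBogoliubov Φ Ψ) (p : Fin n → ℂ) :
    ∃ q, 0 < q ∧ q < 1 / 2 ∧ GaussianBound q (fun z => expKernel Φ Ψ z p) := by
  obtain ⟨q, h0, h1, h2, -⟩ := h.exists_gaussianBound
  refine ⟨q, h0, h1, ?_⟩
  simp only [expKernel_eq_out]
  exact (h2 _).const_mul _

lemma gaussianBound_expKernel_in (h : IsBogoliubov Φ Ψ) (w : Fin n → ℂ) :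
    ∃ q, 0 < q ∧ q < 1 / 2 ∧ GaussianBound q (expKernel Φ Ψ w) := by
  obtain ⟨q, h0, h1, -, h2⟩ := h.exists_gaussianBound
  refine ⟨q, h0, h1, ?_⟩
  rw [show expKernel Φ Ψ w = fun v => _ from funext fun v => expKernel_eq_in Φ Ψ w v]
  exact (h2 _).const_mul _

lemma differentiable_expKernel_out (p : Fin n → ℂ) :
    Differentiable ℂ (fun z => expKernel Φ Ψ z p) := by
  simp only [expKernel_eq_out]
  exact (differentiable_quadExp _ _).const_mul _

lemma differentiable_expKernel_in (w : Fin n → ℂ) : Differentiable ℂ (expKernel Φ Ψ w) := by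
  rw [show expKernel Φ Ψ w = fun v => _ from funext fun v => expKernel_eq_in Φ Ψ w v]
  exact (differentiable_quadExp _ _).const_mul _

lemma annihilation_const_mul (c : ℂ) (hf : Differentiable ℂ f) (j : Fin n) (z : Fin n → ℂ) :
    annihilation j (fun z => c * f z) z = c * annihilation j f z := by
  simp only [annihilation]
  rw [fderiv_const_mul (hf z)]
  simp

lemma annihilation_expKernel_out (h : IsBogoliubov Φ Ψ) (p z : Fin n → ℂ) (j : Fin n) :
    annihilation j (fun z => expKernel Φ Ψ z p) z =
      ((kerOut Φ Ψ *ᵥ z) j + (Φ⁻¹ *ᵥ p) j) * expKernel Φ Ψ z p := by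
  simp only [expKernel_eq_out]
  rw [annihilation_const_mul _ (differentiable_quadExp _ _), hasDerivAt_quadExp h.kerOut_isSymm]
  ring

lemma annihilation_expKernel_in (h : IsBogoliubov Φ Ψ) (w v : Fin n → ℂ) (j : Fin n) :
    annihilation j (expKernel Φ Ψ w) v =
      ((kerIn Φ Ψ *ᵥ v) j + ((Φ⁻¹)ᵀ *ᵥ w) j) * expKernel Φ Ψ w v := by
  rw [show expKernel Φ Ψ w = fun v => _ from funext fun v => expKernel_eq_in Φ Ψ w v]
  rw [annihilation_const_mul _ (differentiable_quadExp _ _), hasDerivAt_quadExp h.kerIn_isSymm]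
  ring

lemma mul_kerOut (h : IsBogoliubov Φ Ψ) : Φ * kerOut Φ Ψ = -Ψ := by
  rw [kerOut, Matrix.mul_neg, mul_nonsing_inv_cancel_left _ _ h.isUnit_det]

/-- The coefficient of the multiplication operators when `b†` acts on a kernel transform; it must
match the one produced by `kernelTransform_creation`. -/
lemma map_star_add (h : IsBogoliubov Φ Ψ) :
    Φ.map star + Ψ.map star * kerOut Φ Ψ = (Φ⁻¹)ᵀ := by
  have hu : (Φ⁻¹)ᵀ * Φᵀ = 1 := by
    rw [← transpose_mul, mul_nonsing_inv _ h.isUnit_det, transpose_one]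
  have h1 := h.blocks_mul
  rw [fromBlocks_multiply, ← fromBlocks_one, fromBlocks_inj] at h1
  have h2 : Ψᴴ * Ψ = Φᵀ * Φᵀᴴ - 1 := by rw [← h1.2.2.2]; simp
  have h3 : kerIn Φ Ψ = (Φ⁻¹)ᵀ * Ψᴴ := by
    rw [← h.kerIn_isSymm.eq, kerIn, transpose_mul]; rfl
  have h4 : Ψ.map star * kerOut Φ Ψ = -(kerIn Φ Ψ * Ψ) := by
    rw [kerIn, kerOut, Matrix.mul_neg, Matrix.mul_assoc]
  rw [h4, h3, Matrix.mul_assoc, h2, Matrix.mul_sub, ← Matrix.mul_assoc, hu, map_star_eq]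
  simp

/-- The integrand of the kernel transform of a function that grows like a vector of the space is
integrable, and so are its products with coordinates. -/
lemma integrable_kernel (h : IsBogoliubov Φ Ψ) (hf : ∀ q, 1 / 2 < q → GaussianBound q f)
    (hm : Measurable f) (w : Fin n → ℂ) :
    Integrable (fun v => expKernel Φ Ψ w v * f (star v)) (bargmannMeasure n) := by
  obtain ⟨q, h0, h1, h2⟩ := h.gaussianBound_expKernel_in w
  -- As `q < 1/2`, the exponent `3/4 - q/2` exceeds `1/2`, and its sum with `q` is still below `1`.
  exact integrable_of_gaussianBound h2 (hf (3 / 4 - q / 2) (by linarith)) (by linarith)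
    (differentiable_expKernel_in w).continuous.measurable hm

lemma expIntegrable_kernel (h : IsBogoliubov Φ Ψ) (hf : GaussianBound (1 / 2) f)
    (hm : Measurable f) :
    ExpIntegrable (fun v => quadExp (kerIn Φ Ψ) 0 v * f (star v)) := by
  obtain ⟨q, h0, h1, -, h2⟩ := h.exists_gaussianBound
  exact ((h2 0).mul hf.comp_star).expIntegrable (by linarith)
    ((differentiable_quadExp _ _).continuous.measurable.mul (hm.comp continuous_star.measurable))

/-- Exhibits the transform as a Gaussian in `w` times a Laplace transform at `Φ⁻ᵀw`, which can be
differentiated under the integral. -/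
lemma kernel_split (w v : Fin n → ℂ) : expKernel Φ Ψ w v * f (star v) = quadExp (kerOut Φ Ψ) 0 w *
    (quadExp (kerIn Φ Ψ) 0 v * f (star v) * Complex.exp (v ⬝ᵥ (Φ⁻¹)ᵀ *ᵥ w)) := by
  have : quadExp (kerIn Φ Ψ) ((Φ⁻¹)ᵀ *ᵥ w) v =
      quadExp (kerIn Φ Ψ) 0 v * Complex.exp (v ⬝ᵥ (Φ⁻¹)ᵀ *ᵥ w) := by
    rw [quadExp, quadExp, ← Complex.exp_add, dotProduct_zero, add_zero]
  rw [expKernel_eq_in, this]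
  ring

lemma kernelTransform_eq (w : Fin n → ℂ) : kernelTransform Φ Ψ f w = quadExp (kerOut Φ Ψ) 0 w *
    ∫ v, quadExp (kerIn Φ Ψ) 0 v * f (star v) * Complex.exp (v ⬝ᵥ (Φ⁻¹)ᵀ *ᵥ w)
      ∂(bargmannMeasure n) := by
  rw [← integral_const_mul]
  exact integral_congr_ae (Filter.Eventually.of_forall fun v => kernel_split w v)

lemma differentiable_kernelTransform (hd : Differentiable ℂ f)
    (hf : GaussianBound (1 / 2) f) (h : IsBogoliubov Φ Ψ) :
    Differentiable ℂ (kernelTransform Φ Ψ f) := by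
  have hL := (h.expIntegrable_kernel hf hd.continuous.measurable).differentiable
  rw [show kernelTransform Φ Ψ f = _ from funext kernelTransform_eq]
  exact (differentiable_quadExp _ _).mul (hL.comp (g := fun x => ∫ v, quadExp (kerIn Φ Ψ) 0 v *
    f (star v) * Complex.exp (v ⬝ᵥ x) ∂(bargmannMeasure n))
    (Φ⁻¹)ᵀ.mulVecLin.toContinuousLinearMap.differentiable)

lemma integrable_coord (hd : Differentiable ℂ f)
    (hf : GaussianBound (1 / 2) f) (h : IsBogoliubov Φ Ψ) (w : Fin n → ℂ) (k : Fin n) :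
    Integrable (fun v => v k * expKernel Φ Ψ w v * f (star v)) (bargmannMeasure n) := by
  have := ((h.expIntegrable_kernel hf hd.continuous.measurable).integrable_coord
    ((Φ⁻¹)ᵀ *ᵥ w) k).const_mul (quadExp (kerOut Φ Ψ) 0 w)
  refine this.congr (Filter.Eventually.of_forall fun v => ?_)
  linear_combination -(v k) * kernel_split (Φ := Φ) (Ψ := Ψ) (f := f) w v

lemma integral_coord (hd : Differentiable ℂ f)
    (hf : GaussianBound (1 / 2) f) (h : IsBogoliubov Φ Ψ) (w : Fin n → ℂ) (k : Fin n) :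
    ∫ v, v k * expKernel Φ Ψ w v * f (star v) ∂(bargmannMeasure n) =
      kernelTransform Φ Ψ (annihilation k f) w := by
  obtain ⟨q, h0, h1, h2⟩ := h.gaussianBound_expKernel_in w
  exact (integral_mul_annihilation h0 (by norm_num) (by linarith) (differentiable_expKernel_in w) hd
    h2 hf k).symm

lemma annihilation_kernelTransform (hd : Differentiable ℂ f)
    (hf : GaussianBound (1 / 2) f) (h : IsBogoliubov Φ Ψ) (w : Fin n → ℂ) (j : Fin n) :
    annihilation j (kernelTransform Φ Ψ f) w =
      (kerOut Φ Ψ *ᵥ w) j * kernelTransform Φ Ψ f w +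
        (Φ⁻¹ *ᵥ fun k => kernelTransform Φ Ψ (annihilation k f) w) j := by
  have hE := h.expIntegrable_kernel hf hd.continuous.measurable
  have hL := hE.differentiable
  have hLd : Differentiable ℂ fun w => ∫ v, quadExp (kerIn Φ Ψ) 0 v * f (star v) *
      Complex.exp (v ⬝ᵥ (Φ⁻¹)ᵀ *ᵥ w) ∂(bargmannMeasure n) :=
    hL.comp (g := fun x => ∫ v, quadExp (kerIn Φ Ψ) 0 v *
      f (star v) * Complex.exp (v ⬝ᵥ x) ∂(bargmannMeasure n))
      (Φ⁻¹)ᵀ.mulVecLin.toContinuousLinearMap.differentiable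
  have h1 : (fun k => kernelTransform Φ Ψ (annihilation k f) w) = quadExp (kerOut Φ Ψ) 0 w •
      fun k => ∫ v, v k * (quadExp (kerIn Φ Ψ) 0 v * f (star v) *
        Complex.exp (v ⬝ᵥ (Φ⁻¹)ᵀ *ᵥ w)) ∂(bargmannMeasure n) := by
    ext k
    rw [← integral_coord hd hf h, Pi.smul_apply, smul_eq_mul, ← integral_const_mul]
    refine integral_congr_ae (Filter.Eventually.of_forall fun v => ?_)
    simp only
    rw [mul_assoc, kernel_split]
    ring
  rw [show kernelTransform Φ Ψ f = _ from funext kernelTransform_eq,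
    annihilation_mul (differentiable_quadExp _ _) hLd, hasDerivAt_quadExp h.kerOut_isSymm,
    annihilation_comp_mulVec hL, h1, mulVec_smul, transpose_transpose]
  simp only [hE.annihilation_eq, Pi.zero_apply, add_zero, Pi.smul_apply, smul_eq_mul]
  ring

/-- Integration by parts moves `v̄_j` onto the kernel as a derivative, which brings down `kerIn v +
Φ⁻ᵀw`; each factor `v_k` is then traded back for `a_k f`. -/
lemma kernelTransform_creation (hd : Differentiable ℂ f)
    (hf : GaussianBound (1 / 2) f) (h : IsBogoliubov Φ Ψ) (w : Fin n → ℂ) (j : Fin n) :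
    kernelTransform Φ Ψ (creation j f) w =
      (kerIn Φ Ψ *ᵥ fun k => kernelTransform Φ Ψ (annihilation k f) w) j +
        ((Φ⁻¹)ᵀ *ᵥ w) j * kernelTransform Φ Ψ f w := by
  obtain ⟨q, h0, h1, h2⟩ := h.gaussianBound_expKernel_in w
  have hi := h.integrable_kernel (fun q hq => hf.mono hq.le) hd.continuous.measurable w
  have hic := fun k => integrable_coord hd hf h w k
  rw [kernelTransform, integral_mul_creation h0 (by norm_num) (by linarith)
    (differentiable_expKernel_in w) hd h2 hf j]
  simp only [h.annihilation_expKernel_in, ← integral_coord hd hf h]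
  simp only [mulVec, dotProduct]
  rw [kernelTransform, ← integral_const_mul]
  simp only [← integral_const_mul]
  rw [← integral_finsetSum _ fun k _ => (hic k).const_mul _, ← integral_add
    (integrable_finsetSum _ fun k _ => (hic k).const_mul _) (hi.const_mul _)]
  refine integral_congr_ae (Filter.Eventually.of_forall fun v => ?_)
  have e : ∑ k, kerIn Φ Ψ j k * (v k * expKernel Φ Ψ w v * f (star v)) =
      (∑ k, kerIn Φ Ψ j k * v k) * (expKernel Φ Ψ w v * f (star v)) := by
    rw [Finset.sum_mul]
    exact Finset.sum_congr rfl fun k _ => by ring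
  simp only [e]
  ring

/-- Differentiating the transform gives a multiplication term with `kerOut`, and `Φ kerOut = -Ψ`
cancels it against the creation part. The function `a_j f` need not lie in the space. -/
theorem bogoliubovAnnihilation_kernelTransform (hd : Differentiable ℂ f)
    (hf : GaussianBound (1 / 2) f) (h : IsBogoliubov Φ Ψ) (j : Fin n) :
    bogoliubovAnnihilation Φ Ψ j (kernelTransform Φ Ψ f) =
      kernelTransform Φ Ψ (annihilation j f) := by
  ext w
  set m := fun k => kernelTransform Φ Ψ (annihilation k f) w with hm
  have e : (fun k => annihilation k (kernelTransform Φ Ψ f) w) =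
      kernelTransform Φ Ψ f w • kerOut Φ Ψ *ᵥ w + Φ⁻¹ *ᵥ m := by
    ext k
    rw [annihilation_kernelTransform hd hf h]
    simp [hm, mul_comm]
  rw [bogoliubovAnnihilation_apply, e, creation_vec, mulVec_add, mulVec_mulVec, mulVec_smul,
    mulVec_smul, mulVec_mulVec, h.mul_kerOut, mul_nonsing_inv _ h.isUnit_det, one_mulVec,
    neg_mulVec]
  simp [hm]

theorem bogoliubovCreation_kernelTransform (hd : Differentiable ℂ f)
    (hf : GaussianBound (1 / 2) f) (h : IsBogoliubov Φ Ψ) (j : Fin n) :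
    bogoliubovCreation Φ Ψ j (kernelTransform Φ Ψ f) =
      kernelTransform Φ Ψ (creation j f) := by
  ext w
  set m := fun k => kernelTransform Φ Ψ (annihilation k f) w with hm
  have e : (fun k => annihilation k (kernelTransform Φ Ψ f) w) =
      kernelTransform Φ Ψ f w • kerOut Φ Ψ *ᵥ w + Φ⁻¹ *ᵥ m := by
    ext k
    rw [annihilation_kernelTransform hd hf h]
    simp [hm, mul_comm]
  rw [bogoliubovCreation_apply, e, creation_vec, kernelTransform_creation hd hf h, ← hm,
    ← h.map_star_add, kerIn, mulVec_add, mulVec_smul, mulVec_smul, mulVec_mulVec, mulVec_mulVec,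
    add_mulVec]
  simp only [Pi.add_apply, Pi.smul_apply, smul_eq_mul]
  ring

end IsBogoliubov

/-! ### Intertwining relations of the inverse kernel -/

namespace IsBogoliubov

variable {Φ Ψ : Matrix (Fin n) (Fin n) ℂ} {f : (Fin n → ℂ) → ℂ}

lemma integrable_kernel_annihilation (hd : Differentiable ℂ f) (hf : GaussianBound (1 / 2) f)
    (h : IsBogoliubov Φ Ψ) (w : Fin n → ℂ) (k : Fin n) :
    Integrable (fun v => expKernel Φ Ψ w v * annihilation k f (star v)) (bargmannMeasure n) :=
  h.integrable_kernel (fun _ hq => hf.annihilation hd (by norm_num) hq k)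
    (measurable_annihilation f k) w

lemma integrable_kernel_creation (hd : Differentiable ℂ f) (hf : GaussianBound (1 / 2) f)
    (h : IsBogoliubov Φ Ψ) (w : Fin n → ℂ) (k : Fin n) :
    Integrable (fun v => expKernel Φ Ψ w v * creation k f (star v)) (bargmannMeasure n) :=
  h.integrable_kernel (fun _ hq => hf.coord_mul hq k)
    (differentiable_creation hd k).continuous.measurable w

lemma kernelTransform_linear (hd : Differentiable ℂ f) (hf : GaussianBound (1 / 2) f)
    (h : IsBogoliubov Φ Ψ) (A B : Matrix (Fin n) (Fin n) ℂ) (j : Fin n) (w : Fin n → ℂ) :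
    kernelTransform Φ Ψ (fun z => (A *ᵥ (fun k => annihilation k f z) +
        B *ᵥ (fun k => creation k f z)) j) w =
      (A *ᵥ (fun k => kernelTransform Φ Ψ (annihilation k f) w) +
        B *ᵥ (fun k => kernelTransform Φ Ψ (creation k f) w)) j := by
  have ia := integrable_kernel_annihilation hd hf h w
  have ic := integrable_kernel_creation hd hf h w
  simp only [kernelTransform, Pi.add_apply, mulVec, dotProduct, ← integral_const_mul]
  rw [← integral_finsetSum _ fun k _ => (ia k).const_mul _,
    ← integral_finsetSum _ fun k _ => (ic k).const_mul _, ← integral_add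
    (integrable_finsetSum _ fun k _ => (ia k).const_mul _)
    (integrable_finsetSum _ fun k _ => (ic k).const_mul _)]
  refine integral_congr_ae (Filter.Eventually.of_forall fun v => ?_)
  simp only [mul_add, Finset.mul_sum]
  congr 1 <;> exact Finset.sum_congr rfl fun k _ => by ring

/-- The transforms of `aₖ f` and `aₖ† f` under the inverse kernel. -/
lemma kernelTransform_inv_vec (hd : Differentiable ℂ f) (hf : GaussianBound (1 / 2) f)
    (h : IsBogoliubov Φ Ψ) (w : Fin n → ℂ) :
    (fun k => kernelTransform Φᴴ (-Ψᵀ) (annihilation k f) w) =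
      Φᴴ *ᵥ (fun k => annihilation k (kernelTransform Φᴴ (-Ψᵀ) f) w) -
        Ψᵀ *ᵥ (fun k => creation k (kernelTransform Φᴴ (-Ψᵀ) f) w) ∧
    (fun k => kernelTransform Φᴴ (-Ψᵀ) (creation k f) w) =
      Φᵀ *ᵥ (fun k => creation k (kernelTransform Φᴴ (-Ψᵀ) f) w) -
        Ψᴴ *ᵥ (fun k => annihilation k (kernelTransform Φᴴ (-Ψᵀ) f) w) := by
  constructor
  · ext k
    rw [← bogoliubovAnnihilation_kernelTransform hd hf h.inv, bogoliubovAnnihilation_apply,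
      neg_mulVec, sub_eq_add_neg]
  · ext k
    have e1 : Φᴴ.map star = Φᵀ := by ext; simp
    have e2 : (-Ψᵀ).map star = -Ψᴴ := by ext; simp
    rw [← bogoliubovCreation_kernelTransform hd hf h.inv, bogoliubovCreation_apply, e1, e2,
      neg_mulVec, sub_eq_add_neg]

/-- The relations for the inverse coefficients express the transforms of `a_k f` and `a_k† f`;
inserting them into `b_j`, the Bogoliubov conditions leave `a_j` alone. This recovers `a_j` from
`b_j` without assuming anything on domains. -/
theorem annihilation_kernelTransform_inv (hd : Differentiable ℂ f)
    (hf : GaussianBound (1 / 2) f) (h : IsBogoliubov Φ Ψ) (j : Fin n) :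
    annihilation j (kernelTransform Φᴴ (-Ψᵀ) f) =
      kernelTransform Φᴴ (-Ψᵀ) (bogoliubovAnnihilation Φ Ψ j f) := by
  ext w
  obtain ⟨ha, hc⟩ := kernelTransform_inv_vec hd hf h w
  have e : bogoliubovAnnihilation Φ Ψ j f = _ := funext (bogoliubovAnnihilation_apply Φ Ψ j f)
  rw [e, kernelTransform_linear hd hf h.inv, ha, hc]
  simp only [mulVec_sub, mulVec_mulVec, h.symm]
  rw [sub_add_sub_comm, add_comm (_ *ᵥ _) (_ *ᵥ _), add_sub_add_left_eq_sub]
  rw [← sub_mulVec, h.unit, one_mulVec]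

theorem creation_kernelTransform_inv (hd : Differentiable ℂ f)
    (hf : GaussianBound (1 / 2) f) (h : IsBogoliubov Φ Ψ) (j : Fin n) :
    creation j (kernelTransform Φᴴ (-Ψᵀ) f) =
      kernelTransform Φᴴ (-Ψᵀ) (bogoliubovCreation Φ Ψ j f) := by
  ext w
  obtain ⟨ha, hc⟩ := kernelTransform_inv_vec hd hf h w
  have e : bogoliubovCreation Φ Ψ j f = fun z => (Ψ.map star *ᵥ (fun k => annihilation k f z) +
      Φ.map star *ᵥ (fun k => creation k f z)) j := funext fun z => by
    rw [bogoliubovCreation_apply, add_comm]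
  rw [e, kernelTransform_linear hd hf h.inv, ha, hc, map_star_eq, map_star_eq]
  simp only [mulVec_sub, mulVec_mulVec, h.conj_symm]
  rw [sub_add_sub_comm, add_comm (_ *ᵥ _) ((Ψᵀᴴ * Φᴴ) *ᵥ _), add_sub_add_left_eq_sub,
    ← sub_mulVec, h.conj_unit, one_mulVec]

/-! ### The images of the coherent vectors -/

lemma expKernel_mem (h : IsBogoliubov Φ Ψ) (p : Fin n → ℂ) :
    (fun z => expKernel Φ Ψ z p) ∈ bargmannSubmodule n := by
  obtain ⟨q, -, h1, h2⟩ := h.gaussianBound_expKernel_out p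
  exact h2.mem h1 (differentiable_expKernel_out p)

/-- The vector `z ↦ expKernel Φ Ψ z p`. -/
def kernelVec (h : IsBogoliubov Φ Ψ) (p : Fin n → ℂ) : BargmannSpace n :=
  ofMem _ (h.expKernel_mem p)

lemma kernelVec_apply (h : IsBogoliubov Φ Ψ) (p z : Fin n → ℂ) :
    h.kernelVec p z = expKernel Φ Ψ z p := rfl

lemma inner_kernelVec (h : IsBogoliubov Φ Ψ) (p : Fin n → ℂ) (f : BargmannSpace n) :
    inner ℂ (h.kernelVec p) f = kernelTransform Φᴴ (-Ψᵀ) f (star p) := by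
  rw [inner_eq, kernelTransform]
  simp only [expKernel_inv, star_star, kernelVec_apply]

lemma bogoliubovAnnihilation_kernelVec (h : IsBogoliubov Φ Ψ) (p z : Fin n → ℂ) (j : Fin n) :
    bogoliubovAnnihilation Φ Ψ j (h.kernelVec p) z = p j * h.kernelVec p z := by
  have e : (fun k => annihilation k (h.kernelVec p) z) =
      expKernel Φ Ψ z p • (kerOut Φ Ψ *ᵥ z + Φ⁻¹ *ᵥ p) := by
    ext k
    refine (h.annihilation_expKernel_out p z k).trans ?_
    simp [mul_comm]
  rw [bogoliubovAnnihilation_apply, e, creation_vec, kernelVec_apply, mulVec_smul, mulVec_smul,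
    mulVec_add, mulVec_mulVec, mulVec_mulVec, h.mul_kerOut, mul_nonsing_inv _ h.isUnit_det,
    one_mulVec, neg_mulVec]
  simp [mul_comm]

lemma kernelTransform_const_mul (c : ℂ) (g : (Fin n → ℂ) → ℂ) (w : Fin n → ℂ) :
    kernelTransform Φ Ψ (fun z => c * g z) w = c * kernelTransform Φ Ψ g w := by
  rw [kernelTransform, kernelTransform, ← integral_const_mul]
  exact integral_congr_ae (Filter.Eventually.of_forall fun v => by simp only; ring)

/-- As a function of `p̄` the left side is the inverse transform of an eigenvector of all `b_j`,
hence an eigenvector of all `∂_j` with eigenvalues `q_j`. -/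
lemma inner_kernelVec_kernelVec_aux (h : IsBogoliubov Φ Ψ) (p q : Fin n → ℂ) :
    inner ℂ (h.kernelVec p) (h.kernelVec q) =
      inner ℂ (h.kernelVec 0) (h.kernelVec q) * Complex.exp (star p ⬝ᵥ q) := by
  rw [inner_kernelVec, inner_kernelVec, star_zero]
  have hd := (h.kernelVec q).2.1
  have hf := gaussianBound_coe (h.kernelVec q)
  rw [eq_const_mul_quadExp (S := 0) (ℓ := q) (by simp [Matrix.IsSymm])
    (differentiable_kernelTransform hd hf h.inv) (fun j z => ?_) (star p)]
  · simp [quadExp]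
  · rw [annihilation_kernelTransform_inv hd hf h, show bogoliubovAnnihilation Φ Ψ j _ = _ from
      funext fun z => h.bogoliubovAnnihilation_kernelVec q z j, kernelTransform_const_mul]
    simp

lemma norm_kernelVec_zero_sq (h : IsBogoliubov Φ Ψ) : ‖h.kernelVec 0‖ ^ 2 = ‖Φ.det‖ := by
  have e : (fun z => expKernel Φ Ψ z 0) = quadExp (kerOut Φ Ψ) 0 := by
    ext z
    rw [expKernel_eq_out]
    simp [quadExp]
  have hmem : quadExp (kerOut Φ Ψ) 0 ∈ bargmannSubmodule n := e ▸ h.expKernel_mem 0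
  have h1 : h.kernelVec 0 = ofMem _ hmem := coe_ext fun z => congrFun e z
  have h2 := h.isUnit_det.ne_zero
  have h3 : ((Φ⁻¹)ᵀ).det = Φ.det⁻¹ := by
    rw [det_transpose, det_nonsing_inv, Ring.inverse_eq_inv']
  rw [h1, norm_sq_quadExp h.kerOut_isSymm (P := (Φ⁻¹)ᵀ) (by rw [h3]; exact inv_ne_zero h2)
    h.sqNorm_sub_sqNorm, h3, norm_inv, inv_inv]

lemma inner_kernelVec_kernelVec (h : IsBogoliubov Φ Ψ) (p q : Fin n → ℂ) :
    inner ℂ (h.kernelVec p) (h.kernelVec q) =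
      ‖Φ.det‖ * inner ℂ (coherent p) (coherent q) := by
  -- Conjugate symmetry moves `q` to the first slot, where the exponential factor becomes `exp 0`.
  have h1 : inner ℂ (h.kernelVec 0) (h.kernelVec q) = (‖Φ.det‖ : ℂ) := by
    rw [← inner_conj_symm, inner_kernelVec_kernelVec_aux, dotProduct_zero, Complex.exp_zero,
      mul_one, inner_self_eq_norm_sq_to_K, h.norm_kernelVec_zero_sq.symm]
    simp
  rw [inner_kernelVec_kernelVec_aux, h1, inner_coherent, coherent_apply]

end IsBogoliubov

/-! ### Unitary operators with given values on the coherent vectors -/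

section Unitary

variable {Φ Ψ : Matrix (Fin n) (Fin n) ℂ} {U : BargmannSpace n ≃ₗᵢ[ℂ] BargmannSpace n} {c : ℂ}

/-- `(Uf)(w) = ⟨e_w̄, Uf⟩ = ⟨U⁻¹e_w̄, f⟩`, and the conjugate of `(U⁻¹e_w̄)(ū)` is `⟨e_w̄, U e_u⟩ =
K(w, u)`. -/
lemma hasIntegralKernel_of_apply_coherent {K : (Fin n → ℂ) → (Fin n → ℂ) → ℂ}
    (hU : ∀ p z, U (coherent p) z = K z p) : HasIntegralKernel U K := by
  intro f w
  have h1 : ∀ u, star ((U.symm (coherent (star w))) (star u)) = K w u := by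
    intro u
    have h2 := inner_coherent u (U.symm (coherent (star w)))
    rw [← U.inner_map_map, U.apply_symm_apply, ← inner_conj_symm, inner_coherent, star_star,
      hU] at h2
    rw [← h2, Complex.star_def, Complex.conj_conj]
  have h2 := BargmannSpace.integrable_inner (U.symm (coherent (star w))) f
  simp only [h1] at h2
  refine ⟨h2, ?_⟩
  have h3 := inner_coherent (star w) (U f)
  rw [star_star, ← U.symm.inner_map_map, U.symm_apply_apply, inner_eq] at h3
  simp only [h1] at h3
  exact h3.symm

lemma apply_eq_kernelTransform
    (hU : ∀ p z, U (coherent p) z = c * expKernel Φ Ψ z p) (f : BargmannSpace n) (w : Fin n → ℂ) :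
    U f w = c * kernelTransform Φ Ψ f w := by
  rw [(hasIntegralKernel_of_apply_coherent hU f w).2, kernelTransform, ← integral_const_mul]
  simp only [mul_assoc]

lemma symm_apply_eq_kernelTransform
    (hU : ∀ p z, U (coherent p) z = c * expKernel Φ Ψ z p)
    (h : IsBogoliubov Φ Ψ) (f : BargmannSpace n)
    (w : Fin n → ℂ) :
    U.symm f w = star c * kernelTransform Φᴴ (-Ψᵀ) f w := by
  have h1 : U (coherent (star w)) = c • h.kernelVec (star w) := coe_ext fun z => hU _ z
  have h2 := inner_coherent (star w) (U.symm f)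
  rw [← U.inner_map_map, U.apply_symm_apply, h1, inner_smul_left, h.inner_kernelVec,
    star_star] at h2
  exact h2.symm

lemma bogoliubovAnnihilation_const_mul {f : (Fin n → ℂ) → ℂ} (hf : Differentiable ℂ f) (c : ℂ)
    (j : Fin n) (z : Fin n → ℂ) : bogoliubovAnnihilation Φ Ψ j (fun z => c * f z) z =
      c * bogoliubovAnnihilation Φ Ψ j f z := by
  have e : (fun k => annihilation k (fun z => c * f z) z) = c • fun k => annihilation k f z := by
    ext k; simp [IsBogoliubov.annihilation_const_mul c hf]
  rw [bogoliubovAnnihilation_apply, bogoliubovAnnihilation_apply, e, creation_vec, creation_vec,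
    mul_smul, mulVec_smul, mulVec_smul, ← smul_add, Pi.smul_apply, smul_eq_mul]

lemma bogoliubovCreation_const_mul {f : (Fin n → ℂ) → ℂ} (hf : Differentiable ℂ f) (c : ℂ)
    (j : Fin n) (z : Fin n → ℂ) : bogoliubovCreation Φ Ψ j (fun z => c * f z) z =
      c * bogoliubovCreation Φ Ψ j f z := by
  have e : (fun k => annihilation k (fun z => c * f z) z) = c • fun k => annihilation k f z := by
    ext k; simp [IsBogoliubov.annihilation_const_mul c hf]
  rw [bogoliubovCreation_apply, bogoliubovCreation_apply, e, creation_vec, creation_vec,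
    mul_smul, mulVec_smul, mulVec_smul, mulVec_smul, ← smul_add, Pi.smul_apply, smul_eq_mul]

/-- From `a_j f = g` the relation for `U` follows by the transform; the converse applies the inverse
transform to `U f` and `U g`. -/
theorem implements_of_apply_coherent
    (hU : ∀ p z, U (coherent p) z = c * expKernel Φ Ψ z p)
    (h : IsBogoliubov Φ Ψ) : Implements U Φ Ψ := by
  have hUf : ∀ f : BargmannSpace n, (U f : (Fin n → ℂ) → ℂ) =
      fun w => c * kernelTransform Φ Ψ f w := fun f => funext (apply_eq_kernelTransform hU f)
  have hUs : ∀ f : BargmannSpace n, (U.symm f : (Fin n → ℂ) → ℂ) =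
      fun w => star c * kernelTransform Φᴴ (-Ψᵀ) f w :=
    fun f => funext (symm_apply_eq_kernelTransform hU h f)
  constructor
  · intro j f g
    constructor
    · intro hb
      have h1 := hUs (U f)
      have h2 := hUs (U g)
      rw [U.symm_apply_apply] at h1 h2
      ext z
      rw [h1, h2, IsBogoliubov.annihilation_const_mul _ (IsBogoliubov.differentiable_kernelTransform
        (U f).2.1 (gaussianBound_coe _) h.inv), IsBogoliubov.annihilation_kernelTransform_inv
        (U f).2.1 (gaussianBound_coe _) h, hb]
    · intro ha
      ext z
      rw [hUf f, hUf g, bogoliubovAnnihilation_const_mul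
        (IsBogoliubov.differentiable_kernelTransform f.2.1 (gaussianBound_coe _) h),
        IsBogoliubov.bogoliubovAnnihilation_kernelTransform f.2.1 (gaussianBound_coe _) h, ha]
  · intro j f g
    constructor
    · intro hb
      have h1 := hUs (U f)
      have h2 := hUs (U g)
      rw [U.symm_apply_apply] at h1 h2
      ext z
      have h3 := congrFun (IsBogoliubov.creation_kernelTransform_inv
        (U f).2.1 (gaussianBound_coe _) h j) z
      rw [hb] at h3
      rw [h1, h2]
      simp only [creation] at h3 ⊢
      linear_combination star c * h3
    · intro ha
      ext z
      rw [hUf f, hUf g, bogoliubovCreation_const_mul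
        (IsBogoliubov.differentiable_kernelTransform f.2.1 (gaussianBound_coe _) h),
        IsBogoliubov.bogoliubovCreation_kernelTransform f.2.1 (gaussianBound_coe _) h, ha]

theorem exists_unitary (h : IsBogoliubov Φ Ψ) (hc : ‖c‖ ^ 2 * ‖Φ.det‖ = 1) :
    ∃ U : BargmannSpace n ≃ₗᵢ[ℂ] BargmannSpace n,
      ∀ p z, U (coherent p) z = c * expKernel Φ Ψ z p := by
  have hc' : (starRingEnd ℂ) c * c * (‖Φ.det‖ : ℂ) = 1 := by
    rw [Complex.conj_mul']; exact_mod_cast hc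
  suffices H : ∃ U : BargmannSpace n ≃ₗᵢ[ℂ] BargmannSpace n,
      ∀ p, U (coherent p) = c • h.kernelVec p by
    obtain ⟨U, hU⟩ := H
    exact ⟨U, fun p z => by rw [hU]; rfl⟩
  refine exists_linearIsometryEquiv_of_inner_eq (t' := fun p => star c • h.inv.kernelVec p)
    eq_zero_of_inner_coherent (fun p q => ?_) (fun p q => ?_) (fun p q => ?_)
  · rw [inner_smul_left, inner_smul_right, h.inner_kernelVec_kernelVec]
    linear_combination inner ℂ (coherent p) (coherent q) * hc'
  · have hdet : ‖Φᴴ.det‖ = ‖Φ.det‖ := by rw [det_conjTranspose, norm_star]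
    rw [inner_smul_left, inner_smul_right, h.inv.inner_kernelVec_kernelVec, hdet,
      Complex.star_def, Complex.conj_conj]
    linear_combination inner ℂ (coherent p) (coherent q) * hc'
  · rw [inner_smul_left, inner_smul_right, ← inner_conj_symm, inner_coherent, inner_coherent,
      IsBogoliubov.kernelVec_apply, IsBogoliubov.kernelVec_apply, expKernel_inv, star_star]
    rfl

/-! ### Uniqueness -/

lemma annihilation_coherent (j : Fin n) (p : Fin n → ℂ) :
    annihilation j (coherent p) = (p j • coherent p : BargmannSpace n) := by
  ext z
  refine (hasDerivAt_quadExp (S := 0) (by simp [Matrix.IsSymm]) p z j).trans ?_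
  change _ = p j * quadExp 0 p z
  simp

lemma creation_coherent_mem (j : Fin n) (p : Fin n → ℂ) :
    creation j (coherent p) ∈ bargmannSubmodule n :=
  ((gaussianBound_quadExp (q := 1 / 4) norm_zero_dotProduct (by norm_num) p).coord_mul
    (q' := 1 / 3) (by norm_num) j).mem (by norm_num)
    (differentiable_creation (differentiable_quadExp _ _) j)

/-- Differentiating the reproducing formula under the integral brings down the factor `u_j`. -/
lemma inner_creation_coherent (j : Fin n) (p : Fin n → ℂ) (f : BargmannSpace n) :
    inner ℂ (ofMem _ (creation_coherent_mem j p)) f = annihilation j f (star p) := by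
  have hE : ExpIntegrable (fun u => f (star u)) :=
    (gaussianBound_coe f).comp_star.expIntegrable (by norm_num)
      (f.2.1.continuous.comp continuous_star).measurable
  have e : (f : (Fin n → ℂ) → ℂ) = fun w => ∫ u, f (star u) * Complex.exp (u ⬝ᵥ w)
      ∂(bargmannMeasure n) := funext fun w => by
    rw [apply_eq_integral]; simp only [mul_comm]
  rw [e, hE.annihilation_eq, inner_eq]
  refine integral_congr_ae (Filter.Eventually.of_forall fun u => ?_)
  have h1 := star_coherent p u
  simp only [ofMem_apply, creation, star_mul', h1, Pi.star_apply, star_star]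
  ring

theorem exists_apply_coherent (h : IsBogoliubov Φ Ψ) (hi : Implements U Φ Ψ) :
    ∃ c : ℂ, ‖c‖ ^ 2 * ‖Φ.det‖ = 1 ∧ ∀ p z, U (coherent p) z = c * expKernel Φ Ψ z p := by
  -- The eigenvalue equations `b_j U e_p = p_j U e_p`, solved for the gradient by means of `Φ⁻¹`.
  have hann : ∀ p z, (fun k => annihilation k (U (coherent p)) z) =
      U (coherent p) z • (kerOut Φ Ψ *ᵥ z + Φ⁻¹ *ᵥ p) := by
    intro p z
    have h1 : Φ *ᵥ (fun k => annihilation k (U (coherent p)) z) + Ψ *ᵥ (U (coherent p) z • z) =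
        U (coherent p) z • p := by
      ext j
      have h2 := congrFun ((hi.annihilation_iff j (coherent p) (p j • coherent p)).2
        (annihilation_coherent j p)) z
      rw [bogoliubovAnnihilation_apply, creation_vec, map_smul] at h2
      rw [h2, Pi.smul_apply, smul_eq_mul, mul_comm]
      rfl
    have h2 := congrArg (fun x => Φ⁻¹ *ᵥ x) h1
    simp only [mulVec_add, mulVec_mulVec, mulVec_smul, nonsing_inv_mul _ h.isUnit_det,
      one_mulVec] at h2
    rw [smul_add, ← h2, kerOut, neg_mulVec]
    simp
  have hg : ∀ p z, U (coherent p) z = U (coherent p) 0 * quadExp (kerOut Φ Ψ) (Φ⁻¹ *ᵥ p) z :=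
    fun p z => eq_const_mul_quadExp h.kerOut_isSymm (U (coherent p)).2.1 (fun j z => by
      rw [show annihilation j (U (coherent p)) z = _ from congrFun (hann p z) j]
      simp [mul_comm]) z
  set x := U.symm (coherent 0) with hx
  have hinner : ∀ f, inner ℂ x f = U f 0 := fun f => by
    rw [← U.inner_map_map, hx, U.apply_symm_apply, inner_coherent, star_zero]
  have hC : ∀ p, U (coherent p) 0 = star (x (star p)) := fun p => by
    rw [← hinner, ← inner_conj_symm, inner_coherent]; rfl
  -- The creation relation on `e_p`, evaluated at `0`: the multiplication operators drop out and the
  -- gradient of `U e_p` there is `(U e_p)(0) Φ⁻¹p`, so the left side has the coefficient `Ψ̄Φ⁻¹p`.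
  have hxann : ∀ p j, annihilation j x (star p) = star ((kerIn Φ Ψ *ᵥ p) j) * x (star p) := by
    intro p j
    have h1 := congrFun ((hi.creation_iff j (coherent p) (ofMem _ (creation_coherent_mem j p))).2
      rfl) 0
    rw [bogoliubovCreation_apply, hann, creation_vec, smul_zero, mulVec_zero, zero_add,
      mulVec_zero, zero_add, mulVec_smul, mulVec_mulVec, ← kerIn, hC, ← hinner (ofMem _ _),
      ← inner_conj_symm, inner_creation_coherent] at h1
    have h2 := congrArg star h1
    simpa [mul_comm] using h2.symm
  have hS : ((kerIn Φ Ψ).map star).IsSymm := by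
    rw [Matrix.IsSymm, ← transpose_map, h.kerIn_isSymm.eq]
  have hxeq : ∀ z, x z = x 0 * quadExp ((kerIn Φ Ψ).map star) 0 z :=
    eq_const_mul_quadExp hS x.2.1 fun j z => by
      have h1 := hxann (star z) j
      rw [star_star] at h1
      rw [h1]
      congr 1
      simp [mulVec, dotProduct]
  have hfin : ∀ p z, U (coherent p) z = star (x 0) * expKernel Φ Ψ z p := by
    intro p z
    rw [hg, hC, hxeq, expKernel_eq_out, star_mul', mul_assoc]
    congr 2
    rw [quadExp, quadExp, Complex.star_def, ← Complex.exp_conj]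
    congr 1
    simp [mulVec, dotProduct, Complex.conj_ofNat]
  refine ⟨star (x 0), ?_, hfin⟩
  have h1 : U (coherent 0) = star (x 0) • h.kernelVec 0 := coe_ext fun z => hfin 0 z
  -- The coherent vector at `0` is the constant `1`, a unit vector; this fixes the modulus of the
  -- constant.
  have h2 : ‖U (coherent (0 : Fin n → ℂ))‖ ^ 2 = 1 := by
    rw [U.norm_map, norm_coherent_sq]
    simp [sqNorm]
  rw [h1, norm_smul, mul_pow, h.norm_kernelVec_zero_sq] at h2
  exact h2

end Unitary

/-- `det ΦΦ* = |det Φ|²` is a positive real, so the complex power has modulus `|det Φ|^(-1/2)`. -/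
lemma norm_sq_det_cpow {Φ : Matrix (Fin n) (Fin n) ℂ} (hΦ : Φ.det ≠ 0) :
    ‖(Φ * Φᴴ).det ^ (-(1 / 4) : ℂ)‖ ^ 2 * ‖Φ.det‖ = 1 := by
  have h0 : 0 < ‖Φ.det‖ := norm_pos_iff.2 hΦ
  have h1 : (Φ * Φᴴ).det = ((‖Φ.det‖ ^ 2 : ℝ) : ℂ) := by
    rw [det_mul, det_conjTranspose, Complex.star_def, Complex.mul_conj']
    push_cast; rfl
  have h2 : (-(1 / 4) : ℂ).re = -(1 / 4) := by norm_num
  rw [h1, Complex.norm_cpow_eq_rpow_re_of_pos (by positivity), h2, ← Real.rpow_natCast,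
    ← Real.rpow_natCast, ← Real.rpow_mul (by positivity), ← Real.rpow_mul (by positivity)]
  norm_num
  rw [Real.rpow_neg_one, inv_mul_cancel₀ h0.ne']

end Bargmann

end

open Bargmann in
theorem theorem4p2 (n : ℕ) (Φ Ψ : Matrix (Fin n) (Fin n) ℂ)
    (hsymm : Φ * Ψᵀ = Ψ * Φᵀ) (hunit : Φ * Φᴴ - Ψ * Ψᴴ = 1) :
    IsUnit Φ ∧
    (bogoliubovMatrix Φ Ψ).IsSymm ∧
    (∀ θ : ℂ, ‖θ‖ = 1 →
      ∃ U : BargmannSpace n ≃ₗᵢ[ℂ] BargmannSpace n,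
        Implements U Φ Ψ ∧ HasIntegralKernel U (bogoliubovKernel Φ Ψ θ)) ∧
    (∀ U : BargmannSpace n ≃ₗᵢ[ℂ] BargmannSpace n, Implements U Φ Ψ →
      ∃ θ : ℂ, ‖θ‖ = 1 ∧ HasIntegralKernel U (bogoliubovKernel Φ Ψ θ)) := by
  have h : IsBogoliubov Φ Ψ := ⟨hsymm, hunit⟩
  have hdet := h.isUnit_det.ne_zero
  have hk := norm_sq_det_cpow hdet
  set κ := (Φ * Φᴴ).det ^ (-(1 / 4) : ℂ) with hκ
  refine ⟨h.isUnit, h.matrixA_isSymm, fun θ hθ => ?_, fun U hU => ?_⟩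
  · obtain ⟨U, hU⟩ := exists_unitary (c := θ * κ) h (by rw [norm_mul, hθ, one_mul, hk])
    exact ⟨U, implements_of_apply_coherent hU h, hasIntegralKernel_of_apply_coherent fun p z => by
      rw [hU, bogoliubovKernel_eq]⟩
  · obtain ⟨c, hc, hcU⟩ := exists_apply_coherent h hU
    have hκ0 : κ ≠ 0 := by
      intro h0
      rw [h0] at hk
      simp at hk
    -- Both `c` and `κ` have squared modulus `1/|det Φ|`, so their quotient is a phase.
    refine ⟨c / κ, ?_, hasIntegralKernel_of_apply_coherent fun p z => ?_⟩
    · have h1 : ‖c‖ ^ 2 = ‖κ‖ ^ 2 :=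
        mul_right_cancel₀ (norm_ne_zero_iff.2 hdet) (hc.trans hk.symm)
      rw [norm_div, (sq_eq_sq₀ (norm_nonneg _) (norm_nonneg _)).1 h1,
        div_self (norm_ne_zero_iff.2 hκ0)]
    · rw [hcU, bogoliubovKernel_eq, ← hκ, div_mul_cancel₀ _ hκ0]
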